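/- Let $p>2$ be prime, let $\mathbb{K}=\mathbb{F}_p(x_{11},x_{12},x_{13},x_{21},x_{22},x_{23})$, and let $G=(\mathbb{Z}/p)^3=\langle e_1,e_2,e_3\rangle$ act on $\mathbb{K}[x,y,z]$ by $\mathbb{K}$-algebra automorphisms with $e_j: x\mapsto x,\ y\mapsto y+x_{1j}x,\ z\mapsto z+2x_{1j}y+(x_{1j}^2+x_{2j})x$ (the generic rank-three three-dimensional representation $V_3$). Let $\Gamma$ be the $8\times 3$ matrix with rows $(x_{1j}^{p^i})_{j}$ (row $2i+1$) and $(x_{2j}^{p^i})_{j}$ (row $2i+2$), $i=0,1,2,3$, and let $\gamma_{abc}$ be the $3\times 3$ minor of $\Gamma$ on rows $a,b,c$. Put $\delta=y^2-xz$, $$f_1=-\gamma_{123}\delta^p-\gamma_{124}x^py^p-\gamma_{134}\delta x^{2p-2}-\gamma_{234}yx^{2p-1},$$ $$f_2=\gamma_{123}y^{p^2}-\gamma_{125}y^px^{p^2-p}-\gamma_{135}\delta x^{p^2-2}-\gamma_{235}yx^{p^2-1},$$ $$f_3=\frac{f_1^p+\gamma_{123}^{p-2}f_2^2+2(-\gamma_{123})^{(p-3)/2}\gamma_{125}x^{p^2-p}f_1^{(p+1)/2}}{-2x^{p^2-2}},$$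 and let $N_G(z)$ be the product of the elements of the $G$-orbit of $z$. Use the graded reverse lexicographic order with $z>y>x$. A subset $\mathcal{B}$ of a subalgebra $A$ is a SAGBI basis of $A$ if the lead monomials of the elements of $\mathcal{B}$ generate the lead term algebra of $A$. To subduct $f$ with respect to $\mathcal{B}=\{b_1,\dots,b_\ell\}$ means to subtract repeatedly from the current non-zero polynomial an expression $c\,b^I=c\,b_1^{I_1}\cdots b_\ell^{I_\ell}$ with $c\in\mathbb{K}$ that has the same lead term; $f$ subducts to $0$ if this can be continued until $0$ is reached. Then $f_3$ is a polynomial (the division is exact), and $\mathcal{B}=\{x,f_1,f_2,f_3,N_G(z)\}$ is a SAGBI basis of $\mathbb{K}[V_3]^G=\mathbb{K}[x,y,z]^G$; in particular $\mathcal{B}$ generates it as a $\mathbb{K}$-algebra. Furthermore, there are exactly two relations among the generators: the relation $$R_1:\quad f_1^p+\gamma_{123}^{p-2}f_2^2+2(-\gamma_{123})^{(p-3)/2}\gamma_{125}x^{p^2-p}f_1^{(p+1)/2}+2x^{p^2-2}f_3=0,$$ and a relation $R_2$ constructed by subducting $$f_3^p+\gamma_{135}^p\gamma_{123}^{p^2-2p-1}f_1f_2^p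 .$$ That is, this element subducts to $0$ with respect to $\mathcal{B}$, and for every such subduction, with $R_2$ the resulting relation (this element minus the sum of the subtracted expressions $c\,b^I$, written as a polynomial in five symbols for the generators), the kernel of the surjection $\mathbb{K}[X_0,\dots,X_4]\to\mathbb{K}[V_3]^G$ that sends $X_0,\dots,X_4$ to $x,f_1,f_2,f_3,N_G(z)$ is the ideal $(R_1,R_2)$, the sequence $R_1,R_2$ is regular in $\mathbb{K}[X_0,\dots,X_4]$, and the kernel is not a principal ideal. Thus $\mathbb{K}[V_3]^G$ is a complete intersection, and its embedding dimension $\dim_{\mathbb{K}}\mathfrak{m}/\mathfrak{m}^2$, with $\mathfrak{m}$ the ideal of invariants without constant term, is $5$. -/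

import Mathlib

open MvPolynomial

noncomputable section

namespace ElemAbelian

/-! ### The graded reverse lexicographic order in three variables

The variables are `X 0 = z`, `X 1 = y`, `X 2 = x`, ordered by `z > y > x`. -/

/-- The exponent `a` is recorded by the partial sums `(a₀ + a₁ + a₂, a₀ + a₁, a₀)`. Comparing these
triples lexicographically compares total degrees first, and for equal degrees the exponent with the
smaller power of the smallest variable is the larger one. See `grevlex_lt_iff`. -/
def grevlexKey (a : Fin 3 →₀ ℕ) : ℕ ×ₗ ℕ ×ₗ ℕ :=
  toLex (a 0 + a 1 + a 2, toLex (a 0 + a 1, a 0))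

lemma grevlexKey_injective : Function.Injective grevlexKey := by
  intro a b h
  have h1 := congrArg (fun t => (ofLex t).1) h
  have h2 := congrArg (fun t => (ofLex (ofLex t).2).1) h
  have h3 := congrArg (fun t => (ofLex (ofLex t).2).2) h
  simp only [grevlexKey, ofLex_toLex] at h1 h2 h3
  ext i
  fin_cases i <;> simp <;> omega

lemma grevlexKey_lt_iff (a b : Fin 3 →₀ ℕ) : grevlexKey a < grevlexKey b ↔
    a 0 + a 1 + a 2 < b 0 + b 1 + b 2 ∨
      (a 0 + a 1 + a 2 = b 0 + b 1 + b 2 ∧ (b 2 < a 2 ∨ (b 2 = a 2 ∧ b 1 < a 1))) := by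
  simp only [grevlexKey, Prod.Lex.toLex_lt_toLex]
  omega

/-- Exponents of monomials in three variables, to be ordered by `grevlexKey`. -/
def GrevlexSyn : Type := Fin 3 →₀ ℕ

instance : AddCommMonoid GrevlexSyn := inferInstanceAs (AddCommMonoid (Fin 3 →₀ ℕ))

instance : LinearOrder GrevlexSyn :=
  LinearOrder.lift' (fun a : GrevlexSyn => grevlexKey a) grevlexKey_injective

lemma grevlexKey_add_le (a b c : Fin 3 →₀ ℕ) (h : grevlexKey a ≤ grevlexKey b) :
    grevlexKey (a + c) ≤ grevlexKey (b + c) := by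
  rw [← not_lt, grevlexKey_lt_iff] at h ⊢
  simp only [Finsupp.add_apply]
  omega

instance : IsOrderedAddMonoid GrevlexSyn where
  add_le_add_left a b h c := grevlexKey_add_le a b c h

instance : WellFoundedLT GrevlexSyn :=
  ⟨InvImage.wf (fun a : GrevlexSyn => grevlexKey a) wellFounded_lt⟩

/-- The graded reverse lexicographic order with `X 0 > X 1 > X 2`. -/
def grevlex : MonomialOrder (Fin 3) where
  syn := GrevlexSyn
  toSyn :=
    { toFun := fun a => a
      invFun := fun a => a
      left_inv := fun _ => rfl
      right_inv := fun _ => rfl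
      map_add' := fun _ _ => rfl }
  toSyn_monotone := by
    intro a b h
    change grevlexKey a ≤ grevlexKey b
    rw [← not_lt, grevlexKey_lt_iff]
    have h0 := h 0
    have h1 := h 1
    have h2 := h 2
    omega

lemma grevlex_lt_iff (a b : Fin 3 →₀ ℕ) : grevlex.toSyn a < grevlex.toSyn b ↔
    a 0 + a 1 + a 2 < b 0 + b 1 + b 2 ∨
      (a 0 + a 1 + a 2 = b 0 + b 1 + b 2 ∧ (b 2 < a 2 ∨ (b 2 = a 2 ∧ b 1 < a 1))) := by
  rw [← grevlexKey_lt_iff]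
  exact Iff.rfl

/-! ### SAGBI bases and subduction -/

section Sagbi

variable {ι σ k : Type*} [Field k]

/-- The subalgebra generated by the lead monomials of the non-zero elements of `S`. For a subalgebra
`S` this is the lead term algebra of `S`. -/
def leadAlgebra (m : MonomialOrder σ) (S : Set (MvPolynomial σ k)) :
    Subalgebra k (MvPolynomial σ k) :=
  Algebra.adjoin k {g | ∃ f ∈ S, f ≠ 0 ∧ g = monomial (m.degree f) 1}

/-- `B` is a SAGBI basis of the subalgebra `A`: it is contained in `A`, and the lead monomials of
its elements generate the lead term algebra of `A`. -/
def IsSagbiBasis (m : MonomialOrder σ) (B : Set (MvPolynomial σ k))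
    (A : Subalgebra k (MvPolynomial σ k)) : Prop :=
  B ⊆ A ∧ leadAlgebra m B = leadAlgebra m (A : Set (MvPolynomial σ k))

/-- `SubductsToZero m B f q`: the subduction algorithm, applied to `f` and the family `B`, has a run
that ends with `0`, and `q` is the sum of the terms `c T^I` for which `c B^I` was subtracted. At each
step `c B^I` is chosen with the same lead term as the current non-zero polynomial. In particular
`f = q(B)`. -/
inductive SubductsToZero (m : MonomialOrder σ) (B : ι → MvPolynomial σ k) :
    MvPolynomial σ k → MvPolynomial ι k → Prop
  | zero : SubductsToZero m B 0 0
  | step (f : MvPolynomial σ k) (I : ι →₀ ℕ) (c : k) (q : MvPolynomial ι k) (hf : f ≠ 0)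
      (hlt : m.leadingTerm (aeval B (monomial I c)) = m.leadingTerm f)
      (hq : SubductsToZero m B (f - aeval B (monomial I c)) q) :
      SubductsToZero m B f (monomial I c + q)

lemma SubductsToZero.aeval_eq {m : MonomialOrder σ} {B : ι → MvPolynomial σ k}
    {f : MvPolynomial σ k} {q : MvPolynomial ι k} (h : SubductsToZero m B f q) :
    aeval B q = f := by
  induction h with
  | zero => simp
  | step f I c q hf hlt hq ih => rw [map_add, ih]; ring

end Sagbi

/-! ### Rings of invariants of matrix representations -/

section Invariants

variable {G k : Type*} [Group G] [Field k] {n : ℕ}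

/-- The action of an invertible matrix `M` on polynomial functions on column vectors:
`f ↦ f ∘ M`, so that the `i`-th coordinate goes to the linear form given by the `i`-th row. -/
def substAct (M : GL (Fin n) k) : MvPolynomial (Fin n) k →ₐ[k] MvPolynomial (Fin n) k :=
  aeval fun i => ∑ j, C (M.1 i j) * X j

/-- The ring of invariants `k[V]^G` of a matrix representation. -/
def invariants (ρ : G →* GL (Fin n) k) : Subalgebra k (MvPolynomial (Fin n) k) :=
  ⨅ g : G, AlgHom.equalizer (substAct (ρ g)) (AlgHom.id k _)

lemma mem_invariants (ρ : G →* GL (Fin n) k) (f : MvPolynomial (Fin n) k) :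
    f ∈ invariants ρ ↔ ∀ g, substAct (ρ g) f = f := by
  simp [invariants, Algebra.mem_iInf, AlgHom.mem_equalizer]

open Classical in
/-- `N_G(f)`: the product of the elements of the `G`-orbit of `f`. -/
def orbitProd [Fintype G] (ρ : G →* GL (Fin n) k) (f : MvPolynomial (Fin n) k) :
    MvPolynomial (Fin n) k :=
  ∏ h ∈ Finset.univ.image (fun g : G => substAct (ρ g) f), h

/-- The ideal of the elements without constant term of a subalgebra of a polynomial ring; for a
ring of invariants it is the homogeneous maximal ideal. -/
def irrelevantIdeal (A : Subalgebra k (MvPolynomial (Fin n) k)) : Ideal A :=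
  RingHom.ker ((constantCoeff (σ := Fin n) (R := k)).comp (algebraMap A (MvPolynomial (Fin n) k)))

/-- The embedding dimension `dim_k 𝔪/𝔪²`, with `𝔪` the ideal of elements without constant term. -/
def embeddingDimension (A : Subalgebra k (MvPolynomial (Fin n) k)) : ℕ :=
  Module.finrank k (irrelevantIdeal A).Cotangent

end Invariants

/-! ### Three dimensional representations of `(ℤ/p)³` -/

section Representation

variable {k : Type*} [Field k]

/-- `σ(c₁, c₂)`. -/
def sigmaMatrix (c₁ c₂ : k) : Matrix (Fin 3) (Fin 3) k :=
  !![1, 2 * c₁, c₁ ^ 2 + c₂; 0, 1, c₁; 0, 0, 1]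

/-- The homomorphism `σ : k² → GL₃(k)`. -/
def sigmaHom : Multiplicative (k × k) →* GL (Fin 3) k :=
  MonoidHom.toHomUnits
    { toFun := fun c => sigmaMatrix c.toAdd.1 c.toAdd.2
      map_one' := by
        ext i j
        fin_cases i <;> fin_cases j <;> simp [sigmaMatrix]
      map_mul' := by
        intro a b
        ext i j
        fin_cases i <;> fin_cases j <;>
          simp [sigmaMatrix, Matrix.mul_apply, Fin.sum_univ_three] <;> ring }

variable (p : ℕ) [Algebra (ZMod p) k]

/-- The representation of `(ℤ/p)³ = ⟨e₁, e₂, e₃⟩` determined by a `2 × 3` matrix `M`, with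
`e_j ↦ σ(M₁ⱼ, M₂ⱼ)`. -/
def repOfMatrix (M : Matrix (Fin 2) (Fin 3) k) :
    Multiplicative (Fin 3 → ZMod p) →* GL (Fin 3) k :=
  sigmaHom.comp (AddMonoidHom.toMultiplicative
    { toFun := fun a => (∑ j, a j • M 0 j, ∑ j, a j • M 1 j)
      map_zero' := by simp
      map_add' := by intro a b; simp [add_smul, Finset.sum_add_distrib] })

lemma repOfMatrix_single (M : Matrix (Fin 2) (Fin 3) k) (j : Fin 3) :
    (repOfMatrix p M (Multiplicative.ofAdd (Pi.single j 1))).1 = sigmaMatrix (M 0 j) (M 1 j) := by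
  have h (i : Fin 2) : ∑ l, (Pi.single j 1 : Fin 3 → ZMod p) l • M i l = M i j := by
    rw [Finset.sum_eq_single j]
    · simp
    · intro b _ hb; simp [Pi.single_eq_of_ne hb]
    · simp
  change sigmaMatrix (∑ l, (Pi.single j 1 : Fin 3 → ZMod p) l • M 0 l)
    (∑ l, (Pi.single j 1 : Fin 3 → ZMod p) l • M 1 l) = _
  rw [h, h]

end Representation

/-! ### The invariants `f₁`, `f₂`, `f₃` -/

section Generators

variable {k : Type*} [Field k] (p : ℕ) (M : Matrix (Fin 2) (Fin 3) k)

/-- The matrix `Γ` with rows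
`M₁, M₂, M₁^p, M₂^p, M₁^(p²), M₂^(p²), M₁^(p³), M₂^(p³)` (entrywise powers of the rows of `M`). -/
def Gam : Matrix (Fin 8) (Fin 3) k := Matrix.of fun i j =>
  if i.val % 2 = 0 then M 0 j ^ p ^ (i.val / 2) else M 1 j ^ p ^ (i.val / 2)

/-- The `3 × 3` minors of `Γ`. Rows are numbered from `0` here, so that the minor usually written
`γ₁₂₃` is `gam p M 0 1 2`. -/
def gam (a b c : Fin 8) : k := ((Gam p M).submatrix ![a, b, c] id).det

/-- `δ = y² - x z`. -/
def del : MvPolynomial (Fin 3) k := X 1 ^ 2 - X 2 * X 0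

/-- `f₁ = -γ₁₂₃ δ^p - γ₁₂₄ x^p y^p - γ₁₃₄ δ x^(2p-2) - γ₂₃₄ y x^(2p-1)`. -/
def f₁ : MvPolynomial (Fin 3) k :=
  -C (gam p M 0 1 2) * del ^ p - C (gam p M 0 1 3) * X 2 ^ p * X 1 ^ p
    - C (gam p M 0 2 3) * del * X 2 ^ (2 * p - 2) - C (gam p M 1 2 3) * X 1 * X 2 ^ (2 * p - 1)

/-- `f₂ = γ₁₂₃ y^(p²) - γ₁₂₅ y^p x^(p²-p) - γ₁₃₅ δ x^(p²-2) - γ₂₃₅ y x^(p²-1)`. -/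
def f₂ : MvPolynomial (Fin 3) k :=
  C (gam p M 0 1 2) * X 1 ^ p ^ 2 - C (gam p M 0 1 4) * X 1 ^ p * X 2 ^ (p ^ 2 - p)
    - C (gam p M 0 2 4) * del * X 2 ^ (p ^ 2 - 2) - C (gam p M 1 2 4) * X 1 * X 2 ^ (p ^ 2 - 1)

/-- The numerator `f₁^p + γ₁₂₃^(p-2) f₂² + 2 (-γ₁₂₃)^((p-3)/2) γ₁₂₅ x^(p²-p) f₁^((p+1)/2)`. -/
def f₃num : MvPolynomial (Fin 3) k :=
  f₁ p M ^ p + C (gam p M 0 1 2 ^ (p - 2)) * f₂ p M ^ 2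
    + C (2 * (-gam p M 0 1 2) ^ ((p - 3) / 2) * gam p M 0 1 4)
      * X 2 ^ (p ^ 2 - p) * f₁ p M ^ ((p + 1) / 2)

/-- `f₃ = f₃num / (-2 x^(p²-2))`. Here `divMonomial` is the quotient of the division by a monomial;
that there is no remainder amounts to the vanishing of `relOne` (below) at the generators. -/
def f₃ : MvPolynomial (Fin 3) k :=
  C ((-2 : k)⁻¹) * (f₃num p M).divMonomial (Finsupp.single 2 (p ^ 2 - 2))

/-- The family `x, f₁, f₂, f₃, N_G(z)`. -/
def gens [Fact p.Prime] [Algebra (ZMod p) k] : Fin 5 → MvPolynomial (Fin 3) k :=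
  ![X 2, f₁ p M, f₂ p M, f₃ p M, orbitProd (repOfMatrix p M) (X 0)]

/-- `f₁^p + γ₁₂₃^(p-2) f₂² + 2 (-γ₁₂₃)^((p-3)/2) γ₁₂₅ x^(p²-p) f₁^((p+1)/2) + 2 x^(p²-2) f₃` as a
polynomial in the symbols `X 0, …, X 4` that stand for `x, f₁, f₂, f₃, N_G(z)`. -/
def relOne : MvPolynomial (Fin 5) k :=
  X 1 ^ p + C (gam p M 0 1 2 ^ (p - 2)) * X 2 ^ 2
    + C (2 * (-gam p M 0 1 2) ^ ((p - 3) / 2) * gam p M 0 1 4)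
      * X 0 ^ (p ^ 2 - p) * X 1 ^ ((p + 1) / 2)
    + 2 * X 0 ^ (p ^ 2 - 2) * X 3

/-- `f₃^p + γ₁₃₅^p γ₁₂₃^(p²-2p-1) f₁ f₂^p` in the same symbols. -/
def teteATete : MvPolynomial (Fin 5) k :=
  X 3 ^ p + C (gam p M 0 2 4 ^ p * gam p M 0 1 2 ^ (p ^ 2 - 2 * p - 1)) * X 1 * X 2 ^ p

end Generators

/-! ### The generic representation -/

/-- The field `𝔽_p(x_{ij} | i = 1, 2, j = 1, 2, 3)`. -/
abbrev GenericField (p : ℕ) [Fact p.Prime] : Type :=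
  FractionRing (MvPolynomial (Fin 2 × Fin 3) (ZMod p))

/-- The generic matrix `(x_{ij})`. -/
def genericMatrix (p : ℕ) [Fact p.Prime] : Matrix (Fin 2) (Fin 3) (GenericField p) :=
  Matrix.of fun i j => algebraMap (MvPolynomial (Fin 2 × Fin 3) (ZMod p)) _ (X (i, j))

/-- The generic rank three representation `e_j ↦ σ(x_{1j}, x_{2j})`. -/
def genericRep (p : ℕ) [Fact p.Prime] :
    Multiplicative (Fin 3 → ZMod p) →* GL (Fin 3) (GenericField p) :=
  repOfMatrix p (genericMatrix p)

/-- The generators `x, f₁, f₂, f₃, N_G(z)` for the generic representation. -/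
def genericGens (p : ℕ) [Fact p.Prime] : Fin 5 → MvPolynomial (Fin 3) (GenericField p) :=
  gens p (genericMatrix p)

end ElemAbelian

end

open MvPolynomial

noncomputable section

namespace ElemAbelian

/-! ### Lead monomials of polynomial expressions -/

section General

variable {ι σ k : Type*} [Field k] {m : MonomialOrder σ} {B : ι → MvPolynomial σ k}

/-! Everything is proved for a matrix `M` over any field of characteristic p with γ₁₂₃ ≠ 0 and γ₁₃₅
≠ 0 (`gam p M 0 1 2` and `gam p M 0 2 4`); genericity enters only through these two conditions.

Modulo x, the generators f₁, f₂, f₃ become non-zero multiples of y^(2p), y^(p²), y^(p²+2), and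
N_G(z) has lead monomial z^(p³). Call a monomial in the generators standard if f₁ and f₃ occur with
exponents below p. Standard monomials have pairwise distinct lead monomials (`injOn_leadExponent`),
also after reduction modulo x when x does not occur. Hence the span S of the standard monomials is
saturated: x f ∈ S implies f ∈ S (`exists_standard_of_X_mul`).

The core is S = K[V]^G (`invariants_eq_standardSpan`). After inverting x, the ring is generated by y
and δ. Give y weight 1 and δ weight 3. Up to powers of x and non-zero scalars, f₁, f₂, f₃, N_G(z)
then have top terms δ^p, y^(p²), δ^(p²), δ^(p³). Division shows that the p³ products y^b δ^c with b
< p², c < p span everything over S, up to powers of x (`mem_localStandard`). Their number is |G|, so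
the matrix of their translates is square, and by Dedekind's independence of characters it is
non-singular. For an invariant f, comparing x^m f = Σ e_(b,c) y^b δ^c with its translates forces x^m
f = e_(0,0) ∈ S, and saturation gives f ∈ S.

The SAGBI property and generation follow. For the relations, R₁ rewrites X₁^p and R₂ rewrites X₃^p,
so every polynomial is standard modulo (R₁, R₂); standard monomials being independent, (R₁, R₂) is
the whole kernel (`ker_aeval_gens`). R₁ is irreducible and does not divide R₂, which gives
regularity and excludes a principal kernel. Neither relation has a linear term, so the embedding
dimension is 5. -/

lemma aeval_monomial_ne_zero (hB : ∀ i, B i ≠ 0) (I : ι →₀ ℕ) {c : k} (hc : c ≠ 0) :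
    aeval B (monomial I c) ≠ 0 := by
  rw [aeval_monomial, Finsupp.prod]
  exact mul_ne_zero (by simpa [algebraMap_eq] using hc)
    (Finset.prod_ne_zero_iff.2 fun i _ => pow_ne_zero _ (hB i))

lemma degree_aeval_monomial (hB : ∀ i, B i ≠ 0) (I : ι →₀ ℕ) {c : k} (hc : c ≠ 0) :
    m.degree (aeval B (monomial I c)) = I.sum fun i n => n • m.degree (B i) := by
  rw [aeval_monomial, Finsupp.prod, MonomialOrder.degree_mul _
    (Finset.prod_ne_zero_iff.2 fun i _ => pow_ne_zero _ (hB i)), MonomialOrder.degree_prod,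
    algebraMap_eq, MonomialOrder.degree_C, zero_add, Finsupp.sum]
  · simp [MonomialOrder.degree_pow]
  · exact fun i _ => pow_ne_zero _ (hB i)
  · simpa [algebraMap_eq] using hc

lemma aeval_monomial_eq_smul (I : ι →₀ ℕ) (c : k) :
    aeval B (monomial I c) = C c * aeval B (monomial I (1 : k)) := by
  rw [aeval_monomial, aeval_monomial, map_one, one_mul, algebraMap_eq]

/-- If the products `B^I`, `I ∈ S`, have pairwise distinct lead monomials, then the lead monomial of
a linear combination of them is one of these lead monomials. -/
lemma exists_degree_aeval_eq (m : MonomialOrder σ) (D : (ι →₀ ℕ) → σ →₀ ℕ) {S : Set (ι →₀ ℕ)}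
    (h0 : ∀ I ∈ S, aeval B (monomial I (1 : k)) ≠ 0)
    (hD : ∀ I ∈ S, m.degree (aeval B (monomial I (1 : k))) = D I) (hS : S.InjOn D)
    {P : MvPolynomial ι k} (hP : P ≠ 0) (hPS : ∀ I ∈ P.support, I ∈ S) :
    aeval B P ≠ 0 ∧ ∃ I ∈ P.support, m.degree (aeval B P) = D I := by
  obtain ⟨J, hJ, hmax⟩ := P.support.exists_max_image (fun I => m.toSyn (D I))
    (Finset.nonempty_iff_ne_empty.2 fun h => hP (support_eq_empty.1 h))
  have hsum : aeval B P = ∑ I ∈ P.support, C (coeff I P) * aeval B (monomial I (1 : k)) := by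
    conv_lhs => rw [P.as_sum, map_sum]
    exact Finset.sum_congr rfl fun I _ => aeval_monomial_eq_smul (B := B) I _
  -- The largest lead monomial occurs in a single summand, so it cannot cancel.
  have hcoeff : coeff (D J) (aeval B P) ≠ 0 := by
    rw [hsum, coeff_sum, Finset.sum_eq_single J, coeff_C_mul, ← hD J (hPS J hJ)]
    · exact mul_ne_zero (mem_support_iff.1 hJ)
        (MonomialOrder.coeff_degree_ne_zero_iff.2 (h0 J (hPS J hJ)))
    · intro I hI hIJ
      rw [coeff_C_mul, m.coeff_eq_zero_of_lt, mul_zero]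
      rw [hD I (hPS I hI)]
      refine lt_of_le_of_ne (hmax I hI) fun h => hIJ (hS (hPS I hI) (hPS J hJ) ?_)
      exact m.toSyn.injective h
    · exact fun h => absurd hJ h
  refine ⟨fun h => hcoeff (by rw [h, coeff_zero]), J, hJ, m.toSyn.injective (le_antisymm ?_ ?_)⟩
  · rw [hsum]
    refine m.degree_sum_le.trans (Finset.sup_le fun I hI => ?_)
    refine le_trans ?_ (hmax I hI)
    refine m.degree_mul_le.trans ?_
    rw [m.degree_C, zero_add, hD I (hPS I hI)]
  · exact m.le_degree (mem_support_iff.2 hcoeff)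

/-! ### Subduction inside a subalgebra -/

lemma toSyn_degree_sub_lt {f g : MvPolynomial σ k} (hfg : f - g ≠ 0)
    (h : m.leadingTerm g = m.leadingTerm f) :
    m.toSyn (m.degree (f - g)) < m.toSyn (m.degree f) := by
  obtain ⟨hc, hd⟩ := MonomialOrder.leadingTerm_eq_leadingTerm_iff.1 h
  have hle : m.toSyn (m.degree (f - g)) ≤ m.toSyn (m.degree f) := by
    refine m.degree_sub_le.trans ?_
    rw [hd, max_self]
  refine lt_of_le_of_ne hle fun he => ?_
  have he' := m.toSyn.injective he
  apply MonomialOrder.coeff_degree_ne_zero_iff.2 hfg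
  rw [he', coeff_sub, sub_eq_zero]
  conv_rhs => rw [← hd]
  exact hc.symm

/-- Each subtraction stays in `A` and strictly lowers the lead monomial, so well-foundedness of the
order ends the process at 0. The hypothesis `hA` is what supplies the next product to subtract. -/
lemma exists_subductsToZero (hB : ∀ i, B i ≠ 0) {A : Subalgebra k (MvPolynomial σ k)}
    (hBA : ∀ i, B i ∈ A)
    (hA : ∀ f ∈ A, f ≠ 0 → ∃ I : ι →₀ ℕ, m.degree f = I.sum fun i n => n • m.degree (B i))
    (f : MvPolynomial σ k) (hf : f ∈ A) : ∃ q, SubductsToZero m B f q := by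
  induction h : m.toSyn (m.degree f) using WellFoundedLT.induction generalizing f with
  | ind s ih =>
  subst h
  by_cases hf0 : f = 0
  · exact ⟨0, hf0 ▸ .zero⟩
  obtain ⟨I, hI⟩ := hA f hf hf0
  set g := aeval B (monomial I (1 : k))
  have hg : g ≠ 0 := aeval_monomial_ne_zero hB I one_ne_zero
  set c := m.leadingCoeff f / m.leadingCoeff g
  have hlc : m.leadingCoeff g ≠ 0 := MonomialOrder.leadingCoeff_ne_zero_iff.2 hg
  have hc : c ≠ 0 := div_ne_zero (MonomialOrder.leadingCoeff_ne_zero_iff.2 hf0) hlc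
  have hlt : m.leadingTerm (aeval B (monomial I c)) = m.leadingTerm f := by
    rw [MonomialOrder.leadingTerm_eq_leadingTerm_iff, hI, degree_aeval_monomial hB I hc]
    refine ⟨?_, rfl⟩
    rw [aeval_monomial_eq_smul, m.leadingCoeff_mul, m.leadingCoeff_C]
    exact div_mul_cancel₀ (m.leadingCoeff f) hlc
  have hmem : f - aeval B (monomial I c) ∈ A := by
    refine A.sub_mem hf ?_
    rw [aeval_monomial]
    exact A.mul_mem (A.algebraMap_mem _) (prod_mem fun i _ => A.pow_mem (hBA i) _)
  by_cases h0 : f - aeval B (monomial I c) = 0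
  · exact ⟨monomial I c + 0, .step f I c 0 hf0 hlt (h0 ▸ .zero)⟩
  · obtain ⟨q, hq⟩ := ih _ (toSyn_degree_sub_lt h0 hlt) _ hmem rfl
    exact ⟨_, .step f I c q hf0 hlt hq⟩

lemma isSagbiBasis_range {A : Subalgebra k (MvPolynomial σ k)} (hB : ∀ i, B i ≠ 0)
    (hBA : ∀ i, B i ∈ A)
    (hA : ∀ f ∈ A, f ≠ 0 → ∃ I : ι →₀ ℕ, m.degree f = I.sum fun i n => n • m.degree (B i)) :
    IsSagbiBasis m (Set.range B) A := by
  refine ⟨by rintro _ ⟨i, rfl⟩; exact hBA i, le_antisymm ?_ ?_⟩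
  · refine Algebra.adjoin_mono ?_
    rintro _ ⟨_, ⟨i, rfl⟩, h0, rfl⟩
    exact ⟨B i, hBA i, h0, rfl⟩
  · refine Algebra.adjoin_le ?_
    rintro _ ⟨f, hf, h0, rfl⟩
    obtain ⟨I, hI⟩ := hA f hf h0
    have : monomial (m.degree f) (1 : k) =
        ∏ i ∈ I.support, monomial (m.degree (B i)) (1 : k) ^ I i := by
      simp_rw [monomial_pow, one_pow]
      rw [hI, Finsupp.sum, monomial_sum_one]
    rw [this]
    refine prod_mem fun i _ => Subalgebra.pow_mem _ (Algebra.subset_adjoin ?_) _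
    exact ⟨B i, ⟨i, rfl⟩, hB i, rfl⟩

/-- Every subtracted term has the lead monomial of the current remainder, and lead monomials of
remainders never increase. -/
lemma SubductsToZero.degree_le (hB : ∀ i, B i ≠ 0) {f : MvPolynomial σ k} {q : MvPolynomial ι k}
    (h : SubductsToZero m B f q) {I : ι →₀ ℕ} (hI : I ∈ q.support) :
    m.toSyn (I.sum fun i n => n • m.degree (B i)) ≤ m.toSyn (m.degree f) := by
  classical
  induction h with
  | zero => simp at hI
  | step f J c q hf hlt hq ih =>
    rcases Finset.mem_union.1 (support_add hI) with h | h
    · obtain rfl := Finset.mem_singleton.1 (support_monomial_subset h)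
      have hc : c ≠ 0 := by
        rintro rfl
        simp at h
      rw [← degree_aeval_monomial hB I hc, (MonomialOrder.leadingTerm_eq_leadingTerm_iff.1 hlt).2]
    · refine (ih h).trans ?_
      refine m.degree_sub_le.trans ?_
      rw [(MonomialOrder.leadingTerm_eq_leadingTerm_iff.1 hlt).2, max_self]

lemma isHomogeneous_aeval_monomial {d : ι → ℕ} (hd : ∀ i, (B i).IsHomogeneous (d i)) (I : ι →₀ ℕ)
    (c : k) : (aeval B (monomial I c)).IsHomogeneous (I.sum fun i n => d i * n) := by
  rw [aeval_monomial, algebraMap_eq, Finsupp.prod, Finsupp.sum, ← zero_add (∑ i ∈ _, _)]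
  exact (isHomogeneous_C σ c).mul
    (IsHomogeneous.prod I.support _ _ fun i _ => (hd i).pow (I i))

/-- A homogeneous product sharing a lead term with a homogeneous remainder has the same degree, so
all remainders stay homogeneous of degree `n`. -/
lemma SubductsToZero.isHomogeneous {d : ι → ℕ}
    (hd : ∀ i, (B i).IsHomogeneous (d i)) {f : MvPolynomial σ k} {q : MvPolynomial ι k}
    (h : SubductsToZero m B f q) {n : ℕ} (hf : f.IsHomogeneous n) {I : ι →₀ ℕ}
    (hI : I ∈ q.support) : (I.sum fun i n => d i * n) = n := by
  classical
  induction h with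
  | zero => simp at hI
  | step f J c q hf0 hlt hq ih =>
    have hJ := isHomogeneous_aeval_monomial hd J c
    obtain ⟨h2, h1⟩ := MonomialOrder.leadingTerm_eq_leadingTerm_iff.1 hlt
    have e1 : (J.sum fun i n => d i * n) = n := by
      have hlf : coeff (m.degree f) f ≠ 0 := MonomialOrder.coeff_degree_ne_zero_iff.2 hf0
      have hlg : coeff (m.degree f) (aeval B (monomial J c)) ≠ 0 := by
        rw [← h1]
        change m.leadingCoeff _ ≠ 0
        rw [h2]
        exact hlf
      exact (hJ.degree_eq_sum_deg_support (mem_support_iff.2 hlg)).trans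
        (hf.degree_eq_sum_deg_support (mem_support_iff.2 hlf)).symm
    rcases Finset.mem_union.1 (support_add hI) with h | h
    · obtain rfl := Finset.mem_singleton.1 (support_monomial_subset h)
      exact e1
    · exact ih (hf.sub (e1 ▸ hJ)) h

end General

/-! ### The shape of `f₁`, `f₂`, `f₃` modulo `x` -/

section Shape

set_option linter.unusedSectionVars false

variable {k : Type*} [Field k] (p : ℕ) [Fact p.Prime] [CharP k p] (M : Matrix (Fin 2) (Fin 3) k)

lemma del_pow_char : (del : MvPolynomial (Fin 3) k) ^ p = X 1 ^ (2 * p) - X 2 ^ p * X 0 ^ p := by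
  rw [del, sub_pow_char, mul_pow, ← pow_mul]

lemma del_pow_char_sq :
    (del : MvPolynomial (Fin 3) k) ^ p ^ 2 = (X 1 ^ p ^ 2) ^ 2 - X 2 ^ p ^ 2 * X 0 ^ p ^ 2 := by
  rw [del, sub_pow_char_pow, mul_pow, ← pow_mul, ← pow_mul, mul_comm 2]

lemma exists_f₁_eq_add_del (hp : 2 < p) :
    ∃ A, f₁ p M = -C (gam p M 0 1 2) * del ^ p + X 2 ^ p * A := by
  obtain ⟨r, rfl⟩ : ∃ r, p = r + 2 := ⟨p - 2, by omega⟩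
  refine ⟨-C (gam (r + 2) M 0 1 3) * X 1 ^ (r + 2) - C (gam (r + 2) M 0 2 3) * del * X 2 ^ r
    - C (gam (r + 2) M 1 2 3) * X 1 * X 2 ^ (r + 1), ?_⟩
  rw [f₁, show 2 * (r + 2) - 2 = (r + 2) + r by omega,
    show 2 * (r + 2) - 1 = (r + 2) + (r + 1) by omega]
  ring

lemma exists_f₁_eq_add (hp : 2 < p) :
    ∃ A, f₁ p M = -C (gam p M 0 1 2) * X 1 ^ (2 * p) + X 2 ^ p * A := by
  obtain ⟨A, hA⟩ := exists_f₁_eq_add_del p M hp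
  refine ⟨A + C (gam p M 0 1 2) * X 0 ^ p, ?_⟩
  rw [hA, del_pow_char]
  ring

/-- Frobenius turns the congruence modulo x^p for f₁ into one modulo x^(p²), enough to survive the
division by x^(p²-2). -/
lemma exists_f₁_pow_char_eq (hp : 2 < p) :
    ∃ A, f₁ p M ^ p = -C (gam p M 0 1 2 ^ p) * (X 1 ^ p ^ 2) ^ 2 + X 2 ^ p ^ 2 * A := by
  obtain ⟨A, hA⟩ := exists_f₁_eq_add_del p M hp
  refine ⟨A ^ p + C (gam p M 0 1 2 ^ p) * X 0 ^ p ^ 2, ?_⟩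
  have hodd : Odd p := (Fact.out : p.Prime).odd_of_ne_two hp.ne'
  rw [hA, add_pow_char, mul_pow, mul_pow, hodd.neg_pow, ← map_pow, ← pow_mul, ← pow_mul, ← pow_two,
    del_pow_char_sq]
  ring

lemma exists_f₁_pow_eq (hp : 2 < p) (n : ℕ) :
    ∃ A, f₁ p M ^ n = C ((-gam p M 0 1 2) ^ n) * X 1 ^ (2 * p * n) + X 2 ^ p * A := by
  obtain ⟨A, hA⟩ := exists_f₁_eq_add p M hp
  -- Since a - b divides aⁿ - bⁿ, the congruence modulo x^p passes from f₁ to its powers.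
  have h := sub_dvd_pow_sub_pow (f₁ p M) (-C (gam p M 0 1 2) * X 1 ^ (2 * p)) n
  rw [hA, add_sub_cancel_left, ← hA] at h
  obtain ⟨D, hD⟩ := (Dvd.intro _ rfl).trans h
  refine ⟨D, ?_⟩
  rw [← hD, mul_pow, ← map_neg, ← map_pow, ← pow_mul]
  ring

lemma exists_f₂_eq_add (hp : 2 < p) :
    ∃ A, f₂ p M = C (gam p M 0 1 2) * X 1 ^ p ^ 2 + X 2 * A := by
  have h1 : p < p ^ 2 := by nlinarith
  refine ⟨-C (gam p M 0 1 4) * X 1 ^ p * X 2 ^ (p ^ 2 - p - 1)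
    - C (gam p M 0 2 4) * del * X 2 ^ (p ^ 2 - 3) - C (gam p M 1 2 4) * X 1 * X 2 ^ (p ^ 2 - 2), ?_⟩
  rw [f₂, show p ^ 2 - p = p ^ 2 - p - 1 + 1 by omega, show p ^ 2 - 2 = p ^ 2 - 3 + 1 by omega,
    show p ^ 2 - 1 = p ^ 2 - 3 + 1 + 1 by omega]
  simp only [Nat.add_sub_cancel]
  ring

/-- The y^(2p²) terms of f₁^p and γ₁₂₃^(p-2) f₂² cancel. The cross term of f₂² in x^(p²-p) y^(p²+p)
is cancelled by the third summand of the numerator. What remains is divisible by x^(p²-2), and its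
lowest term in x is the cross term of γ₁₂₃ y^(p²) with γ₁₃₅ δ x^(p²-2), where δ ≡ y² modulo x. -/
lemma exists_f₃num_eq (hp : 2 < p) :
    ∃ A, f₃num p M = X 2 ^ (p ^ 2 - 2) *
      (C (-2 * (gam p M 0 1 2 ^ (p - 1) * gam p M 0 2 4)) * X 1 ^ (p ^ 2 + 2) + X 2 * A) := by
  obtain ⟨A₁, h₁⟩ := exists_f₁_pow_char_eq p M hp
  obtain ⟨A₂, h₂⟩ := exists_f₁_pow_eq p M hp ((p + 1) / 2)
  obtain ⟨r, hr⟩ : ∃ r, p = 2 * r + 3 := by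
    obtain ⟨r, hr⟩ := (Fact.out : p.Prime).odd_of_ne_two hp.ne'
    exact ⟨r - 1, by omega⟩
  have e1 : (p + 1) / 2 = r + 2 := by omega
  have e2 : (p - 3) / 2 = r := by omega
  have e3 : p - 2 = 2 * r + 1 := by omega
  have e4 : p - 1 = 2 * r + 2 := by omega
  have hsq : p ^ 2 = 3 * p + 2 * r * p := by rw [hr]; ring
  have e5 : 2 * p * (r + 2) = p ^ 2 + p := by rw [hr]; ring
  rw [f₃num, h₁, h₂, f₂, e1, e2, e3, e4, e5]
  set γ := gam p M 0 1 2
  set x : MvPolynomial (Fin 3) k := X 2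
  set y : MvPolynomial (Fin 3) k := X 1
  have hle : 3 * p ≤ p ^ 2 := by omega
  have hu1 : x ^ (p ^ 2 - 1) = x ^ (p ^ 2 - 2) * x := by rw [← pow_succ]; congr 1; omega
  have hu2 : x ^ p ^ 2 = x ^ (p ^ 2 - 2) * x ^ 2 := by rw [← pow_add]; congr 1; omega
  have hu3 : x ^ (p ^ 2 - p) * x ^ (p ^ 2 - p) = x ^ (p ^ 2 - 2) * x * x ^ (p ^ 2 - 2 * p + 1) := by
    rw [← pow_add, ← pow_succ, ← pow_add]; congr 1; omega
  have hu4 : x ^ (p ^ 2 - p) * x ^ p = x ^ (p ^ 2 - 2) * x ^ 2 := by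
    rw [← pow_add, ← pow_add]; congr 1; omega
  have hu5 : x ^ (p ^ 2 - p) = x * x ^ (p ^ 2 - p - 1) := by rw [← pow_succ']; congr 1; omega
  have hu6 : x ^ (p ^ 2 - 2) = x * x ^ (p ^ 2 - 3) := by rw [← pow_succ']; congr 1; omega
  -- The signs disappear because r + (r + 2) is even; the result is γ₁₂₃^(p-1), the coefficient of
  -- the cross term to be cancelled.
  have hγ : (-C γ : MvPolynomial (Fin 3) k) ^ r * (-C γ) ^ (r + 2) = C γ ^ (2 * r + 2) := by
    rw [← pow_add, show r + (r + 2) = 2 * (r + 1) by ring, pow_mul, neg_sq, ← pow_mul]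
    congr 1
  have hγ1 : (C γ : MvPolynomial (Fin 3) k) ^ p = C γ ^ (2 * r + 1) * C γ ^ 2 := by
    rw [← pow_add]; congr 1
  have hy : y ^ (p ^ 2 + 2) = y ^ p ^ 2 * y ^ 2 := pow_add _ _ _
  have hy1 : y ^ (p ^ 2 + p) = y ^ p ^ 2 * y ^ p := pow_add _ _ _
  simp only [map_mul, map_pow, map_neg, map_ofNat]
  rw [hu1, hu2, hγ1, hy, hy1]
  set D : MvPolynomial (Fin 3) k := C (gam p M 0 2 4) * del + C (gam p M 1 2 4) * y * x
  refine ⟨x * A₁ + 2 * (-C γ) ^ r * C (gam p M 0 1 4) * x * A₂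
    + 2 * C γ ^ (2 * r + 2) * y ^ p ^ 2 * (C (gam p M 0 2 4) * X 0 - C (gam p M 1 2 4) * y)
    + C γ ^ (2 * r + 1) * (C (gam p M 0 1 4) ^ 2 * (y ^ p) ^ 2 * x ^ (p ^ 2 - 2 * p + 1)
      + 2 * C (gam p M 0 1 4) * y ^ p * x ^ (p ^ 2 - p - 1) * D + x ^ (p ^ 2 - 3) * D ^ 2), ?_⟩
  have hdel : (del : MvPolynomial (Fin 3) k) = y ^ 2 - x * X 0 := rfl
  simp only [D, hdel]
  set u := x ^ (p ^ 2 - 2)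
  set w := x ^ (p ^ 2 - p)
  set G : MvPolynomial (Fin 3) k := C γ
  set Y := y ^ p ^ 2
  set a : MvPolynomial (Fin 3) k := C (gam p M 0 1 4)
  set b : MvPolynomial (Fin 3) k := C (gam p M 0 2 4)
  set c : MvPolynomial (Fin 3) k := C (gam p M 1 2 4)
  linear_combination 2 * a * w * Y * y ^ p * hγ + 2 * (-G) ^ r * a * A₂ * hu4
    + G ^ (2 * r + 1) * a ^ 2 * (y ^ p) ^ 2 * hu3
    + 2 * G ^ (2 * r + 1) * a * y ^ p * u * (b * (y ^ 2 - x * X 0) + c * y * x) * hu5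
    + G ^ (2 * r + 1) * u * (b * (y ^ 2 - x * X 0) + c * y * x) ^ 2 * hu6

lemma two_ne_zero_of_char (hp : 2 < p) : (2 : k) ≠ 0 := by
  intro h
  have := (CharP.cast_eq_zero_iff k p 2).1 (by exact_mod_cast h)
  exact absurd (Nat.le_of_dvd two_pos this) (by omega)

lemma f₃num_eq_mul_f₃ (hp : 2 < p) : f₃num p M = -2 * X 2 ^ (p ^ 2 - 2) * f₃ p M := by
  obtain ⟨A, hA⟩ := exists_f₃num_eq p M hp
  have h2 := two_ne_zero_of_char (k := k) p hp
  have : (-2 : MvPolynomial (Fin 3) k) * C ((-2 : k)⁻¹) = 1 := by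
    rw [show (-2 : MvPolynomial (Fin 3) k) = C (-2) by rw [C_neg, map_ofNat], ← C_mul, mul_inv_cancel₀, C_1]
    exact neg_ne_zero.2 h2
  rw [f₃, hA, X_pow_eq_monomial, divMonomial_monomial_mul]
  linear_combination (-(monomial (Finsupp.single 2 (p ^ 2 - 2)) (1 : k)) *
    (C (-2 * (gam p M 0 1 2 ^ (p - 1) * gam p M 0 2 4)) * X 1 ^ (p ^ 2 + 2) + X 2 * A)) * this

lemma exists_f₃_eq_add (hp : 2 < p) :
    ∃ A, f₃ p M = C (gam p M 0 1 2 ^ (p - 1) * gam p M 0 2 4) * X 1 ^ (p ^ 2 + 2) + X 2 * A := by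
  obtain ⟨A, hA⟩ := exists_f₃num_eq p M hp
  have h2 := two_ne_zero_of_char (k := k) p hp
  refine ⟨C ((-2 : k)⁻¹) * A, ?_⟩
  rw [f₃, hA, X_pow_eq_monomial, divMonomial_monomial_mul, mul_add, ← mul_assoc, ← C_mul,
    inv_mul_cancel_left₀ (neg_ne_zero.2 h2)]
  ring

/-! ### Homogeneity and lead monomials -/

lemma IsHomogeneous.of_eq {f : MvPolynomial (Fin 3) k} {m n : ℕ} (hf : f.IsHomogeneous m)
    (h : m = n) : f.IsHomogeneous n := h ▸ hf

lemma isHomogeneous_del : (del : MvPolynomial (Fin 3) k).IsHomogeneous 2 :=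
  ((isHomogeneous_X k 1).pow 2).sub ((isHomogeneous_X k 2).mul (isHomogeneous_X k 0))

lemma isHomogeneous_f₁ (hp : 2 < p) : (f₁ p M).IsHomogeneous (2 * p) := by
  have hC (c : k) := isHomogeneous_C (Fin 3) c
  have hX (i : Fin 3) := isHomogeneous_X k i
  refine ((IsHomogeneous.sub ?_ ?_).sub ?_).sub ?_
  · exact (by simpa using (hC _).neg.mul (isHomogeneous_del.pow p))
  · exact IsHomogeneous.of_eq (((hC (gam p M 0 1 3)).mul ((hX 2).pow p)).mul ((hX 1).pow p)) (by omega)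
  · exact IsHomogeneous.of_eq (((hC (gam p M 0 2 3)).mul isHomogeneous_del).mul ((hX 2).pow (2 * p - 2))) (by omega)
  · exact IsHomogeneous.of_eq (((hC (gam p M 1 2 3)).mul (hX 1)).mul ((hX 2).pow (2 * p - 1))) (by omega)

lemma isHomogeneous_f₂ (hp : 2 < p) : (f₂ p M).IsHomogeneous (p ^ 2) := by
  have hC (c : k) := isHomogeneous_C (Fin 3) c
  have hX (i : Fin 3) := isHomogeneous_X k i
  have h1 : p < p ^ 2 := by nlinarith
  refine ((IsHomogeneous.sub ?_ ?_).sub ?_).sub ?_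
  · exact IsHomogeneous.of_eq ((hC (gam p M 0 1 2)).mul ((hX 1).pow (p ^ 2))) (by omega)
  · exact IsHomogeneous.of_eq (((hC (gam p M 0 1 4)).mul ((hX 1).pow p)).mul ((hX 2).pow (p ^ 2 - p))) (by omega)
  · exact IsHomogeneous.of_eq (((hC (gam p M 0 2 4)).mul isHomogeneous_del).mul ((hX 2).pow (p ^ 2 - 2))) (by omega)
  · exact IsHomogeneous.of_eq (((hC (gam p M 1 2 4)).mul (hX 1)).mul ((hX 2).pow (p ^ 2 - 1))) (by omega)

lemma isHomogeneous_f₃ (hp : 2 < p) : (f₃ p M).IsHomogeneous (p ^ 2 + 2) := by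
  have hC (c : k) := isHomogeneous_C (Fin 3) c
  have h1 : 3 * p ≤ p ^ 2 := by nlinarith
  have hf := isHomogeneous_f₁ p M hp
  have hnum : (f₃num p M).IsHomogeneous (2 * p ^ 2) := by
    refine (IsHomogeneous.add ?_ ?_).add ?_
    · convert hf.pow p using 1; ring
    · convert (hC (gam p M 0 1 2 ^ (p - 2))).mul ((isHomogeneous_f₂ p M hp).pow 2) using 1; ring
    · convert ((hC (2 * (-gam p M 0 1 2) ^ ((p - 3) / 2) * gam p M 0 1 4)).mul
        ((isHomogeneous_X k 2).pow (p ^ 2 - p))).mul (hf.pow ((p + 1) / 2)) using 1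
      obtain ⟨r, hr⟩ := (Fact.out : p.Prime).odd_of_ne_two hp.ne'
      have : 2 * p * ((p + 1) / 2) = p ^ 2 + p := by
        rw [show (p + 1) / 2 = r + 1 by omega, hr]; ring
      omega
  rw [f₃, ← zero_add (p ^ 2 + 2)]
  refine (hC _).mul fun d hd => ?_
  rw [coeff_divMonomial] at hd
  have := hnum hd
  simp only [map_add, Finsupp.weight_single, Pi.one_apply, smul_eq_mul, mul_one] at this
  omega

/-- In a fixed degree every monomial divisible by x is smaller than every monomial free of x, so the
lead monomial can be read off modulo x. -/
lemma grevlex_degree_eq_of_isHomogeneous {g : MvPolynomial (Fin 3) k} {n : ℕ}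
    (hg : g.IsHomogeneous n) {c : k} (hc : c ≠ 0) {A : MvPolynomial (Fin 3) k}
    (h : g = C c * X 1 ^ n + X 2 * A) : grevlex.degree g = Finsupp.single 1 n := by
  classical
  have hcoeff (d : Fin 3 →₀ ℕ) (hd : d 2 = 0) :
      coeff d g = if Finsupp.single 1 n = d then c else 0 := by
    rw [h, coeff_add, coeff_C_mul, coeff_X_pow, coeff_X_mul',
      if_neg (show 2 ∉ d.support from fun h2 => Finsupp.mem_support_iff.1 h2 hd), add_zero, mul_ite,
      mul_one, mul_zero]
  apply grevlex.toSyn.injective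
  refine le_antisymm (MonomialOrder.degree_le_iff.2 fun d hd => ?_)
    (grevlex.le_degree (mem_support_iff.2 ?_))
  · have hdeg : n = d 0 + d 1 + d 2 := by
      rw [hg.degree_eq_sum_deg_support hd, ← Fin.sum_univ_three]
      exact Finset.sum_subset (Finset.subset_univ _) fun i _ hi => Finsupp.notMem_support_iff.1 hi
    rw [← not_lt, grevlex_lt_iff]
    rcases eq_or_ne (d 2) 0 with h2 | h2
    · have := hcoeff d h2
      rw [mem_support_iff] at hd
      split_ifs at this with h3
      · simp [← h3]
      · exact absurd this hd
    · simp only [Finsupp.single_apply]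
      simp
      omega
  · rw [hcoeff _ (by simp), if_pos rfl]
    exact hc

end Shape

/-! ### The group action and the invariance of the generators -/

section Action

set_option linter.unusedSectionVars false

variable {k : Type*} [Field k] (p : ℕ) [Fact p.Prime] [Algebra (ZMod p) k] [CharP k p]
  (M : Matrix (Fin 2) (Fin 3) k)

/-- The action of the group element with exponent vector `a`. -/
def shift (a : Fin 3 → ZMod p) : MvPolynomial (Fin 3) k →ₐ[k] MvPolynomial (Fin 3) k :=
  substAct (repOfMatrix p M (Multiplicative.ofAdd a))

lemma mem_invariants_iff_shift (f : MvPolynomial (Fin 3) k) :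
    f ∈ invariants (repOfMatrix p M) ↔ ∀ a, shift p M a f = f :=
  mem_invariants _ _

/-- The combination of the columns of `Γ` with coefficients `a`. -/
def gamComb (a : Fin 3 → ZMod p) (r : Fin 8) : k := ∑ j, a j • Gam p M r j

lemma gamComb_add (a b : Fin 3 → ZMod p) (r : Fin 8) :
    gamComb p M (a + b) r = gamComb p M a r + gamComb p M b r := by
  simp [gamComb, add_smul, Finset.sum_add_distrib]

lemma sum_smul_pow_char_pow (a : Fin 3 → ZMod p) (i : Fin 2) (e : ℕ) :
    (∑ j, a j • M i j) ^ p ^ e = ∑ j, a j • M i j ^ p ^ e := by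
  rw [sum_pow_char_pow]
  simp [smul_pow, ZMod.pow_card_pow]

lemma gamComb_two (a : Fin 3 → ZMod p) : gamComb p M a 2 = gamComb p M a 0 ^ p := by
  have := sum_smul_pow_char_pow p M a 0 1
  simpa [gamComb, Gam] using this.symm

lemma gamComb_three (a : Fin 3 → ZMod p) : gamComb p M a 3 = gamComb p M a 1 ^ p := by
  have := sum_smul_pow_char_pow p M a 1 1
  simpa [gamComb, Gam] using this.symm

lemma gamComb_four (a : Fin 3 → ZMod p) : gamComb p M a 4 = gamComb p M a 0 ^ p ^ 2 := by
  have := sum_smul_pow_char_pow p M a 0 2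
  simpa [gamComb, Gam] using this.symm

/-- Border the rows r, s, t, u of Γ by a combination of its columns: the resulting 4 × 4 determinant
vanishes, and this is its expansion along the extra column. -/
lemma gamComb_relation (a : Fin 3 → ZMod p) (r s t u : Fin 8) :
    gam p M s t u * gamComb p M a r - gam p M r t u * gamComb p M a s
      + gam p M r s u * gamComb p M a t - gam p M r s t * gamComb p M a u = 0 := by
  simp only [gamComb, gam, Matrix.det_fin_three, Matrix.submatrix_apply, id_eq, Matrix.cons_val,
    Fin.sum_univ_three, Algebra.smul_def]
  ring

/-- This is faithfulness of the representation: vanishing on row 1 of Γ propagates by Frobenius to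
row 3, and rows 1, 2, 3 form an invertible matrix. -/
lemma eq_zero_of_gamComb_eq_zero (hγ : gam p M 0 1 2 ≠ 0) {a : Fin 3 → ZMod p}
    (h0 : gamComb p M a 0 = 0) (h1 : gamComb p M a 1 = 0) : a = 0 := by
  have h2 : gamComb p M a 2 = 0 := by
    rw [gamComb_two, h0, zero_pow (Fact.out : p.Prime).ne_zero]
  have := Matrix.eq_zero_of_mulVec_eq_zero (v := fun j => algebraMap (ZMod p) k (a j)) hγ (by
    ext i
    simp only [gamComb, Algebra.smul_def] at h0 h1 h2
    fin_cases i
    · simpa [Matrix.mulVec, dotProduct, mul_comm] using h0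
    · simpa [Matrix.mulVec, dotProduct, mul_comm] using h1
    · simpa [Matrix.mulVec, dotProduct, mul_comm] using h2)
  ext j
  exact (algebraMap (ZMod p) k).injective (by simpa using congrFun this j)

lemma shift_X_zero (a : Fin 3 → ZMod p) : shift p M a (X 0) = X 0
    + C (2 * gamComb p M a 0) * X 1 + C (gamComb p M a 0 ^ 2 + gamComb p M a 1) * X 2 := by
  have h : (repOfMatrix p M (Multiplicative.ofAdd a)).1 =
    sigmaMatrix (∑ j, a j • M 0 j) (∑ j, a j • M 1 j) := rfl
  simp [shift, substAct, h, sigmaMatrix, Fin.sum_univ_three, gamComb, Gam]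

lemma shift_X_one (a : Fin 3 → ZMod p) : shift p M a (X 1) = X 1 + C (gamComb p M a 0) * X 2 := by
  have h : (repOfMatrix p M (Multiplicative.ofAdd a)).1 =
    sigmaMatrix (∑ j, a j • M 0 j) (∑ j, a j • M 1 j) := rfl
  simp [shift, substAct, h, sigmaMatrix, Fin.sum_univ_three, gamComb, Gam]

lemma shift_X_two (a : Fin 3 → ZMod p) : shift p M a (X 2) = X 2 := by
  have h : (repOfMatrix p M (Multiplicative.ofAdd a)).1 =
    sigmaMatrix (∑ j, a j • M 0 j) (∑ j, a j • M 1 j) := rfl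
  simp [shift, substAct, h, sigmaMatrix, Fin.sum_univ_three]

lemma shift_C (a : Fin 3 → ZMod p) (c : k) : shift p M a (C c) = C c :=
  (shift p M a).commutes c

lemma shift_del (a : Fin 3 → ZMod p) :
    shift p M a del = del - C (gamComb p M a 1) * X 2 ^ 2 := by
  simp only [del, map_sub, map_mul, map_pow, shift_X_zero, shift_X_one, shift_X_two, map_add,
    map_ofNat]
  ring

lemma shift_shift_X_zero (a b : Fin 3 → ZMod p) :
    shift p M a (shift p M b (X 0)) = shift p M (a + b) (X 0) := by
  simp only [shift_X_zero, shift_X_one, shift_X_two, map_add, map_mul, map_pow, shift_C, gamComb_add,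
    map_ofNat]
  ring

/-- A group element changes y and δ only by multiples of x and x², so f₁ changes by x^(2p) times a
scalar, which is the bordered determinant for rows 1, 2, 3, 4. The same argument with rows 1, 2, 3,
5 and x^(p²) handles f₂. -/
lemma f₁_mem_invariants (hp : 2 < p) : f₁ p M ∈ invariants (repOfMatrix p M) := by
  rw [mem_invariants_iff_shift]
  intro a
  have hrel := congrArg (C (σ := Fin 3)) (gamComb_relation p M a 0 1 2 3)
  have hodd : Odd p := (Fact.out : p.Prime).odd_of_ne_two hp.ne'
  obtain ⟨r, rfl⟩ : ∃ r, p = r + 2 := ⟨p - 2, by omega⟩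
  rw [gamComb_two, gamComb_three] at hrel
  simp only [f₁, map_sub, map_mul, map_pow, map_neg, shift_C, shift_X_one, shift_X_two, shift_del,
    map_add, map_zero] at hrel ⊢
  rw [sub_pow_char, add_pow_char, show 2 * (r + 2) - 2 = (r + 2) + r by omega,
    show 2 * (r + 2) - 1 = (r + 2) + (r + 1) by omega]
  linear_combination (-X 2 ^ (2 * (r + 2))) * hrel

lemma f₂_mem_invariants (hp : 2 < p) : f₂ p M ∈ invariants (repOfMatrix p M) := by
  rw [mem_invariants_iff_shift]
  intro a
  have hrel := congrArg (C (σ := Fin 3)) (gamComb_relation p M a 0 1 2 4)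
  have h1 : p < p ^ 2 := by nlinarith
  rw [gamComb_two, gamComb_four] at hrel
  simp only [f₂, map_sub, map_mul, map_pow, shift_C, shift_X_one, shift_X_two, shift_del,
    map_add, map_zero] at hrel ⊢
  have e1 : (X 2 : MvPolynomial (Fin 3) k) ^ p ^ 2 = X 2 ^ p * X 2 ^ (p ^ 2 - p) := by
    rw [← pow_add]; congr 1; omega
  have e2 : (X 2 : MvPolynomial (Fin 3) k) ^ p ^ 2 = X 2 ^ 2 * X 2 ^ (p ^ 2 - 2) := by
    rw [← pow_add]; congr 1; omega
  have e3 : (X 2 : MvPolynomial (Fin 3) k) ^ p ^ 2 = X 2 * X 2 ^ (p ^ 2 - 1) := by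
    rw [← pow_succ']; congr 1; omega
  rw [add_pow_char_pow, add_pow_char, mul_pow, mul_pow]
  linear_combination (-X 2 ^ p ^ 2) * hrel
    + C (gam p M 0 1 4) * C (gamComb p M a 0) ^ p * e1
    - C (gam p M 0 2 4) * C (gamComb p M a 1) * e2
    + C (gam p M 1 2 4) * C (gamComb p M a 0) * e3

lemma f₃_mem_invariants (hp : 2 < p) : f₃ p M ∈ invariants (repOfMatrix p M) := by
  have h1 := (mem_invariants_iff_shift p M _).1 (f₁_mem_invariants p M hp)
  have h2 := (mem_invariants_iff_shift p M _).1 (f₂_mem_invariants p M hp)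
  rw [mem_invariants_iff_shift]
  intro a
  have hnum : shift p M a (f₃num p M) = f₃num p M := by
    simp only [f₃num, map_add, map_mul, map_pow, h1, h2, shift_X_two, shift_C]
  rw [f₃num_eq_mul_f₃ p M hp, map_mul, map_mul, map_pow, shift_X_two, map_neg, map_ofNat] at hnum
  refine mul_left_cancel₀ (mul_ne_zero (neg_ne_zero.2 ?_) (pow_ne_zero _ (X_ne_zero 2))) hnum
  rw [← map_ofNat (C (σ := Fin 3) (R := k)), C_ne_zero]
  exact two_ne_zero_of_char p hp

lemma shift_X_zero_injective (hp : 2 < p) (hγ : gam p M 0 1 2 ≠ 0) :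
    Function.Injective fun a => shift p M a (X 0) := by
  intro a b h
  simp only [shift_X_zero] at h
  have e1 := congrArg (eval ![0, 1, 0]) h
  have e2 := congrArg (eval ![0, 0, 1]) h
  simp [two_ne_zero_of_char (k := k) p hp] at e1 e2
  have key (r : Fin 8) (hr : gamComb p M a r = gamComb p M b r) : gamComb p M (a - b) r = 0 := by
    have := gamComb_add p M (a - b) b r
    rw [sub_add_cancel, hr] at this
    simpa using this
  rw [e1] at e2
  exact sub_eq_zero.1 (eq_zero_of_gamComb_eq_zero p M hγ (key 0 e1) (key 1 (by simpa using e2)))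

/-- The stabilizer of z is trivial, so the orbit product has one factor for each group element. -/
lemma orbitProd_eq_prod_shift (hp : 2 < p) (hγ : gam p M 0 1 2 ≠ 0) :
    orbitProd (repOfMatrix p M) (X 0) = ∏ a, shift p M a (X 0) := by
  classical
  have hinj := shift_X_zero_injective p M hp hγ
  rw [orbitProd, Finset.prod_image]
  · exact Fintype.prod_equiv Multiplicative.toAdd _ _ fun a => rfl
  · intro a _ b _ h
    exact Multiplicative.toAdd.injective (hinj h)

lemma orbitProd_mem_invariants (hp : 2 < p) (hγ : gam p M 0 1 2 ≠ 0) :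
    orbitProd (repOfMatrix p M) (X 0) ∈ invariants (repOfMatrix p M) := by
  rw [mem_invariants_iff_shift]
  intro a
  rw [orbitProd_eq_prod_shift p M hp hγ, map_prod]
  simp only [shift_shift_X_zero]
  exact Fintype.prod_equiv (Equiv.addLeft a) _ _ fun b => rfl

lemma card_exponents : Fintype.card (Fin 3 → ZMod p) = p ^ 3 := by
  simp [ZMod.card]

lemma isHomogeneous_shift_X_zero (a : Fin 3 → ZMod p) : (shift p M a (X 0)).IsHomogeneous 1 := by
  rw [shift_X_zero]
  have h (c : k) (i : Fin 3) : (C c * X i).IsHomogeneous 1 := by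
    simpa using (isHomogeneous_C (Fin 3) c).mul (isHomogeneous_X k i)
  exact ((isHomogeneous_X k 0).add (h _ 1)).add (h _ 2)

lemma isHomogeneous_orbitProd (hp : 2 < p) (hγ : gam p M 0 1 2 ≠ 0) :
    (orbitProd (repOfMatrix p M) (X 0)).IsHomogeneous (p ^ 3) := by
  rw [orbitProd_eq_prod_shift p M hp hγ, ← card_exponents p, Fintype.card_eq_sum_ones]
  exact IsHomogeneous.prod _ _ _ fun a _ => isHomogeneous_shift_X_zero p M a

lemma grevlex_degree_linear (c d : k) :
    (X 0 + C c * X 1 + C d * X 2 : MvPolynomial (Fin 3) k) ≠ 0 ∧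
    grevlex.degree (X 0 + C c * X 1 + C d * X 2) = Finsupp.single 0 1 := by
  have lt1 : grevlex.toSyn (Finsupp.single 1 1) < grevlex.toSyn (Finsupp.single 0 1) := by
    rw [grevlex_lt_iff]; simp
  have lt2 : grevlex.toSyn (Finsupp.single 2 1) < grevlex.toSyn (Finsupp.single 0 1) := by
    rw [grevlex_lt_iff]; simp
  have hle (c : k) (i : Fin 3) :
      grevlex.toSyn (grevlex.degree (C c * X i)) ≤ grevlex.toSyn (Finsupp.single i 1) := by
    rw [← monomial_zero', X, monomial_mul, zero_add]
    exact grevlex.degree_monomial_le _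
  have h1 : grevlex.degree (X 0 + C c * X 1 : MvPolynomial (Fin 3) k) = Finsupp.single 0 1 := by
    rw [MonomialOrder.degree_add_of_lt, MonomialOrder.degree_X]
    rw [MonomialOrder.degree_X]
    exact (hle c 1).trans_lt lt1
  have h2 : grevlex.degree (X 0 + C c * X 1 + C d * X 2 : MvPolynomial (Fin 3) k) =
      Finsupp.single 0 1 := by
    rw [MonomialOrder.degree_add_of_lt, h1]
    rw [h1]
    exact (hle d 2).trans_lt lt2
  refine ⟨grevlex.ne_zero_of_degree_ne_zero ?_, h2⟩
  rw [h2]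
  simp

end Action

/-! ### Lead monomials of the generators -/

section LeadMonomials

set_option linter.unusedSectionVars false

variable {k : Type*} [Field k] (p : ℕ) [Fact p.Prime] [Algebra (ZMod p) k] [CharP k p]
  (M : Matrix (Fin 2) (Fin 3) k)

/-- The degrees of the generators. -/
def genDegree : Fin 5 → ℕ := ![1, 2 * p, p ^ 2, p ^ 2 + 2, p ^ 3]

/-- The exponents of the lead monomials of the generators. -/
def genExponent : Fin 5 → Fin 3 →₀ ℕ :=
  ![Finsupp.single 2 1, Finsupp.single 1 (2 * p), Finsupp.single 1 (p ^ 2),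
    Finsupp.single 1 (p ^ 2 + 2), Finsupp.single 0 (p ^ 3)]

/-- The exponent of the lead monomial of a product of powers of the generators. -/
def leadExponent (I : Fin 5 →₀ ℕ) : Fin 3 →₀ ℕ := I.sum fun i n => n • genExponent p i

/-- The exponents of the standard monomials. -/
def standardExponents : Set (Fin 5 →₀ ℕ) := {I | I 1 < p ∧ I 3 < p}

lemma leadExponent_eq (I : Fin 5 →₀ ℕ) : leadExponent p I = ∑ i, I i • genExponent p i :=
  Finsupp.sum_fintype _ _ (by simp)

lemma leadExponent_add (I J : Fin 5 →₀ ℕ) :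
    leadExponent p (I + J) = leadExponent p I + leadExponent p J := by
  simp [leadExponent_eq, add_smul, Finset.sum_add_distrib]

lemma leadExponent_apply_zero (I : Fin 5 →₀ ℕ) : leadExponent p I 0 = I 4 * p ^ 3 := by
  simp [leadExponent_eq, Fin.sum_univ_five, genExponent]

lemma leadExponent_apply_one (I : Fin 5 →₀ ℕ) :
    leadExponent p I 1 = I 1 * (2 * p) + I 2 * p ^ 2 + I 3 * (p ^ 2 + 2) := by
  simp [leadExponent_eq, Fin.sum_univ_five, genExponent, mul_add]

lemma leadExponent_apply_two (I : Fin 5 →₀ ℕ) : leadExponent p I 2 = I 0 := by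
  simp [leadExponent_eq, Fin.sum_univ_five, genExponent]

lemma eq_of_two_mul_modEq (hp : 2 < p) {a b : ℕ} (ha : a < p) (hb : b < p)
    (h : 2 * a ≡ 2 * b [MOD p]) : a = b := by
  have hcop : Nat.Coprime p 2 :=
    ((Nat.coprime_primes (Fact.out : p.Prime) Nat.prime_two).2 hp.ne')
  exact (h.cancel_left_of_coprime hcop).eq_of_lt_of_lt ha hb

/-- The exponents of z and x determine I₄ and I₀. The exponent of y is 2 I₃ modulo p, which fixes I₃
< p as p is odd. Dividing the rest by p leaves 2 I₁ + p I₂, which fixes I₁ < p and then I₂. -/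
lemma injOn_leadExponent (hp : 2 < p) : (standardExponents p).InjOn (leadExponent p) := by
  rintro I ⟨hI1, hI3⟩ J ⟨hJ1, hJ3⟩ h
  have h0 := DFunLike.congr_fun h 0
  have h1 := DFunLike.congr_fun h 1
  have h2 := DFunLike.congr_fun h 2
  rw [leadExponent_apply_zero, leadExponent_apply_zero] at h0
  rw [leadExponent_apply_one, leadExponent_apply_one] at h1
  rw [leadExponent_apply_two, leadExponent_apply_two] at h2
  have hp0 : 0 < p := by omega
  have e4 : I 4 = J 4 := Nat.eq_of_mul_eq_mul_right (pow_pos hp0 3) h0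
  have e3 : I 3 = J 3 := by
    refine eq_of_two_mul_modEq p hp hI3 hJ3 ?_
    have hmod (K : Fin 5 →₀ ℕ) :
        K 1 * (2 * p) + K 2 * p ^ 2 + K 3 * (p ^ 2 + 2) ≡ 2 * K 3 [MOD p] := by
      rw [show K 1 * (2 * p) + K 2 * p ^ 2 + K 3 * (p ^ 2 + 2) =
        2 * K 3 + p * (2 * K 1 + K 2 * p + K 3 * p) by ring]
      simp [Nat.ModEq]
    exact (hmod I).symm.trans (h1 ▸ hmod J)
  have h1' : 2 * I 1 + p * I 2 = 2 * J 1 + p * J 2 := by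
    refine Nat.eq_of_mul_eq_mul_right hp0 ?_
    rw [e3] at h1
    linarith
  have e1 : I 1 = J 1 := by
    refine eq_of_two_mul_modEq p hp hI1 hJ1 ?_
    have hmod (K : Fin 5 →₀ ℕ) : 2 * K 1 + p * K 2 ≡ 2 * K 1 [MOD p] := by simp [Nat.ModEq]
    exact (hmod I).symm.trans (h1' ▸ hmod J)
  have e2 : I 2 = J 2 := Nat.eq_of_mul_eq_mul_left hp0 (by omega)
  ext i
  fin_cases i <;> assumption

lemma grevlex_degree_C_mul_X_one_pow {c : k} (hc : c ≠ 0) (n : ℕ) :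
    grevlex.degree (C c * X 1 ^ n) = Finsupp.single 1 n := by
  classical
  rw [X_pow_eq_monomial, C_mul_monomial, mul_one, MonomialOrder.degree_monomial, if_neg hc]

lemma isHomogeneous_gens (hp : 2 < p) (hγ : gam p M 0 1 2 ≠ 0) (i : Fin 5) :
    (gens p M i).IsHomogeneous (genDegree p i) := by
  fin_cases i
  · exact isHomogeneous_X k 2
  · exact isHomogeneous_f₁ p M hp
  · exact isHomogeneous_f₂ p M hp
  · exact isHomogeneous_f₃ p M hp
  · exact isHomogeneous_orbitProd p M hp hγ

lemma grevlex_degree_gens (hp : 2 < p) (hγ : gam p M 0 1 2 ≠ 0) (hη : gam p M 0 2 4 ≠ 0)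
    (i : Fin 5) : grevlex.degree (gens p M i) = genExponent p i := by
  fin_cases i
  · exact MonomialOrder.degree_X
  · obtain ⟨A, hA⟩ := exists_f₁_eq_add p M hp
    refine grevlex_degree_eq_of_isHomogeneous (isHomogeneous_f₁ p M hp) (neg_ne_zero.2 hγ)
      (A := X 2 ^ (p - 1) * A) ?_
    change f₁ p M = _
    rw [hA, C_neg, ← mul_assoc (X 2), ← pow_succ', Nat.sub_add_cancel (by omega)]
  · obtain ⟨A, hA⟩ := exists_f₂_eq_add p M hp
    exact grevlex_degree_eq_of_isHomogeneous (isHomogeneous_f₂ p M hp) hγ hA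
  · obtain ⟨A, hA⟩ := exists_f₃_eq_add p M hp
    exact grevlex_degree_eq_of_isHomogeneous (isHomogeneous_f₃ p M hp)
      (mul_ne_zero (pow_ne_zero _ hγ) hη) hA
  · change grevlex.degree (orbitProd (repOfMatrix p M) (X 0)) = Finsupp.single 0 (p ^ 3)
    rw [orbitProd_eq_prod_shift p M hp hγ, MonomialOrder.degree_prod]
    · simp only [shift_X_zero, (grevlex_degree_linear _ _).2]
      simp [ZMod.card]
    · intro a _
      rw [shift_X_zero]
      exact (grevlex_degree_linear _ _).1

lemma gens_ne_zero (hp : 2 < p) (hγ : gam p M 0 1 2 ≠ 0) (hη : gam p M 0 2 4 ≠ 0) (i : Fin 5) :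
    gens p M i ≠ 0 := by
  refine grevlex.ne_zero_of_degree_ne_zero ?_
  rw [grevlex_degree_gens p M hp hγ hη]
  have : p ≠ 0 := by omega
  fin_cases i
  · exact Finsupp.single_ne_zero.2 one_ne_zero
  · exact Finsupp.single_ne_zero.2 (mul_ne_zero two_ne_zero this)
  · exact Finsupp.single_ne_zero.2 (pow_ne_zero 2 this)
  · exact Finsupp.single_ne_zero.2 (show p ^ 2 + 2 ≠ 0 by omega)
  · exact Finsupp.single_ne_zero.2 (pow_ne_zero 3 this)

lemma gens_mem_invariants (hp : 2 < p) (hγ : gam p M 0 1 2 ≠ 0) (i : Fin 5) :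
    gens p M i ∈ invariants (repOfMatrix p M) := by
  fin_cases i
  · exact (mem_invariants_iff_shift p M _).2 (shift_X_two p M)
  · exact f₁_mem_invariants p M hp
  · exact f₂_mem_invariants p M hp
  · exact f₃_mem_invariants p M hp
  · exact orbitProd_mem_invariants p M hp hγ

/-! ### Standard expressions modulo `x` -/

/-- Reduction modulo `x`. -/
def modX : MvPolynomial (Fin 3) k →ₐ[k] MvPolynomial (Fin 3) k := aeval ![X 0, X 1, 0]

lemma grevlex_degree_modX_gens (hp : 2 < p) (hγ : gam p M 0 1 2 ≠ 0) (hη : gam p M 0 2 4 ≠ 0)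
    {i : Fin 5} (hi : i ≠ 0) :
    modX (gens p M i) ≠ 0 ∧ grevlex.degree (modX (gens p M i)) = genExponent p i := by
  have hX (n : ℕ) {c : k} (hc : c ≠ 0) : (C c * X 1 ^ n : MvPolynomial (Fin 3) k) ≠ 0 :=
    mul_ne_zero (C_ne_zero.2 hc) (pow_ne_zero _ (X_ne_zero 1))
  have hη' : gam p M 0 1 2 ^ (p - 1) * gam p M 0 2 4 ≠ 0 := mul_ne_zero (pow_ne_zero _ hγ) hη
  fin_cases i
  · exact absurd rfl hi
  · obtain ⟨A, hA⟩ := exists_f₁_eq_add p M hp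
    have : modX (gens p M 1) = C (-gam p M 0 1 2) * X 1 ^ (2 * p) := by
      change modX (f₁ p M) = _
      rw [hA]
      simp [modX, (Fact.out : p.Prime).ne_zero]
    simp only [Fin.mk_one, this]
    exact ⟨hX _ (neg_ne_zero.2 hγ), grevlex_degree_C_mul_X_one_pow (neg_ne_zero.2 hγ) _⟩
  · obtain ⟨A, hA⟩ := exists_f₂_eq_add p M hp
    have : modX (gens p M 2) = C (gam p M 0 1 2) * X 1 ^ p ^ 2 := by
      change modX (f₂ p M) = _
      rw [hA]
      simp [modX]
    simp only [Fin.reduceFinMk, this]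
    exact ⟨hX _ hγ, grevlex_degree_C_mul_X_one_pow hγ _⟩
  · obtain ⟨A, hA⟩ := exists_f₃_eq_add p M hp
    have : modX (gens p M 3) = C (gam p M 0 1 2 ^ (p - 1) * gam p M 0 2 4) * X 1 ^ (p ^ 2 + 2) := by
      change modX (f₃ p M) = _
      rw [hA]
      simp [modX]
    simp only [Fin.reduceFinMk, this]
    exact ⟨hX _ hη', grevlex_degree_C_mul_X_one_pow hη' _⟩
  · have hlin (a : Fin 3 → ZMod p) : modX (shift p M a (X 0)) =
        X 0 + C (2 * gamComb p M a 0) * X 1 + C 0 * X 2 := by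
      rw [shift_X_zero]
      simp [modX]
    have : modX (gens p M 4) = ∏ a, modX (shift p M a (X 0)) := by
      change modX (orbitProd (repOfMatrix p M) (X 0)) = _
      rw [orbitProd_eq_prod_shift p M hp hγ, map_prod]
    have h0 (a : Fin 3 → ZMod p) : modX (shift p M a (X 0)) ≠ 0 := by
      rw [hlin]
      exact (grevlex_degree_linear _ _).1
    simp only [Fin.reduceFinMk, this]
    refine ⟨Finset.prod_ne_zero_iff.2 fun a _ => h0 a, ?_⟩
    rw [MonomialOrder.degree_prod fun a _ => h0 a]
    simp only [hlin, (grevlex_degree_linear _ _).2]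
    simp [ZMod.card, genExponent]

/-- Reduction modulo x preserves the lead monomials of the generators other than x, so the standard
monomials without x stay linearly independent modulo x. -/
lemma eq_zero_of_modX_aeval_gens_eq_zero (hp : 2 < p) (hγ : gam p M 0 1 2 ≠ 0)
    (hη : gam p M 0 2 4 ≠ 0) {P : MvPolynomial (Fin 5) k}
    (hP : ∀ I ∈ P.support, I ∈ standardExponents p ∧ I 0 = 0)
    (h : modX (aeval (gens p M) P) = 0) : P = 0 := by
  by_contra hP0
  obtain ⟨B, hB', hB⟩ : ∃ B : Fin 5 → MvPolynomial (Fin 3) k,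
      (∀ i ≠ 0, B i = modX (gens p M i)) ∧
        ∀ i, B i ≠ 0 ∧ grevlex.degree (B i) = genExponent p i := by
    -- The generator x itself reduces to 0. Putting x back in its place keeps the family non-zero
    -- and is harmless, since the exponent of that generator is 0 throughout.
    refine ⟨Function.update (fun i => modX (gens p M i)) 0 (X 2),
      fun i hi => Function.update_of_ne hi _ _, fun i => ?_⟩
    rcases eq_or_ne i 0 with rfl | hi
    · rw [Function.update_self]
      exact ⟨X_ne_zero 2, MonomialOrder.degree_X⟩
    · rw [Function.update_of_ne hi]
      exact grevlex_degree_modX_gens p M hp hγ hη hi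
  have hmon (I : Fin 5 →₀ ℕ) (hI : I 0 = 0) :
      aeval (fun i => modX (gens p M i)) (monomial I (1 : k)) =
        aeval B (monomial I (1 : k)) := by
    rw [aeval_monomial, aeval_monomial, map_one, one_mul, one_mul]
    refine Finset.prod_congr rfl fun i hi => ?_
    have : i ≠ 0 := by
      rintro rfl
      exact Finsupp.mem_support_iff.1 hi hI
    simp only [hB' i this]
  refine (exists_degree_aeval_eq (B := fun i => modX (gens p M i)) grevlex (leadExponent p)
    (S := {I | I ∈ standardExponents p ∧ I 0 = 0}) ?_ ?_ ?_ hP0 hP).1 ?_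
  · rintro I ⟨_, hI⟩
    rw [hmon I hI]
    exact aeval_monomial_ne_zero (fun i => (hB i).1) I one_ne_zero
  · rintro I ⟨_, hI⟩
    rw [hmon I hI, degree_aeval_monomial (fun i => (hB i).1) I one_ne_zero]
    exact Finset.sum_congr rfl fun i _ => by simp only [(hB i).2]
  · exact (injOn_leadExponent p hp).mono fun I hI => hI.1
  · rw [← h, ← AlgHom.comp_apply]
    congr 1
    ext i
    simp

lemma exists_standard_of_X_mul (hp : 2 < p) (hγ : gam p M 0 1 2 ≠ 0) (hη : gam p M 0 2 4 ≠ 0)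
    {h : MvPolynomial (Fin 3) k} {P : MvPolynomial (Fin 5) k}
    (hP : ∀ I ∈ P.support, I ∈ standardExponents p) (hh : aeval (gens p M) P = X 2 * h) :
    ∃ Q : MvPolynomial (Fin 5) k,
      (∀ I ∈ Q.support, I ∈ standardExponents p) ∧ aeval (gens p M) Q = h := by
  -- In P = X₀ Q + R with R free of X₀, the image of R is divisible by x. Hence R = 0, and x can be
  -- cancelled.
  set Q := P.divMonomial (Finsupp.single 0 1) with hQ
  set R := P.modMonomial (Finsupp.single 0 1) with hR
  have hPQR : X 0 * Q + R = P := divMonomial_add_modMonomial_single P 0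
  have hgx : aeval (gens p M) (X 0 : MvPolynomial (Fin 5) k) = X 2 := by simp [gens]
  have hRsupp : ∀ I ∈ R.support, I ∈ standardExponents p ∧ I 0 = 0 := by
    intro I hI
    rw [mem_support_iff] at hI
    by_cases h1 : Finsupp.single 0 1 ≤ I
    · exact absurd (coeff_modMonomial_of_le P h1) hI
    · rw [hR, coeff_modMonomial_of_not_le P h1] at hI
      refine ⟨hP I (mem_support_iff.2 hI), ?_⟩
      rw [Finsupp.single_le_iff] at h1
      omega
  have hR0 : R = 0 := by
    refine eq_zero_of_modX_aeval_gens_eq_zero p M hp hγ hη hRsupp ?_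
    have hx : modX (X 2 : MvPolynomial (Fin 3) k) = 0 := by simp [modX]
    have := congrArg modX hh
    rw [← hPQR, map_add, map_mul, hgx, map_add, map_mul, map_mul, hx, zero_mul, zero_mul,
      zero_add] at this
    exact this
  refine ⟨Q, fun I hI => ?_, ?_⟩
  · rw [mem_support_iff, hQ, coeff_divMonomial] at hI
    have := hP _ (mem_support_iff.2 hI)
    simpa [standardExponents] using this
  · rw [← hPQR, hR0, add_zero, map_mul, hgx] at hh
    exact mul_left_cancel₀ (X_ne_zero 2) hh

end LeadMonomials

/-! ### Division with respect to the weights `1` of `y` and `3` of `δ` -/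

section Division

set_option linter.unusedSectionVars false

variable {k : Type*} [Field k] (p : ℕ) [Fact p.Prime] [Algebra (ZMod p) k] [CharP k p]
  (M : Matrix (Fin 2) (Fin 3) k)

/-- The span of the products `x^m y^b δ^c` with `b + 3c < n`. -/
def weightLT (k : Type*) [Field k] (n : ℕ) : Submodule k (MvPolynomial (Fin 3) k) :=
  Submodule.span k {g | ∃ m b c : ℕ, b + 3 * c < n ∧ g = X 2 ^ m * (X 1 ^ b * del ^ c)}

lemma weightLT_mono {m n : ℕ} (h : m ≤ n) : weightLT k m ≤ weightLT k n :=
  Submodule.span_mono fun _ ⟨l, b, c, hbc, hg⟩ => ⟨l, b, c, hbc.trans_le h, hg⟩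

lemma mem_weightLT {n b c : ℕ} (h : b + 3 * c < n) (u : k) (m : ℕ) :
    C u * (X 2 ^ m * (X 1 ^ b * del ^ c)) ∈ weightLT k n := by
  rw [← smul_eq_C_mul]
  exact Submodule.smul_mem _ _ (Submodule.subset_span ⟨m, b, c, h, rfl⟩)

/-- The strict bound `n + 1` on one factor means weight at most n, so a factor of exact top weight
costs only n. -/
lemma mul_mem_weightLT {m n : ℕ} {f g : MvPolynomial (Fin 3) k} (hf : f ∈ weightLT k m)
    (hg : g ∈ weightLT k (n + 1)) : f * g ∈ weightLT k (m + n) := by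
  have h := Submodule.mul_mem_mul hf hg
  rw [weightLT, weightLT, Submodule.span_mul_span] at h
  refine Submodule.span_mono ?_ h
  rintro _ ⟨_, ⟨l, b, c, hbc, rfl⟩, _, ⟨l', b', c', hbc', rfl⟩, rfl⟩
  exact ⟨l + l', b + b', c + c', by omega, by simp only [pow_add]; ring⟩

/-- `g` is `u y^b δ^c` up to terms of smaller weight. -/
def HasTop (g : MvPolynomial (Fin 3) k) (u : k) (b c : ℕ) : Prop :=
  g - C u * (X 1 ^ b * del ^ c) ∈ weightLT k (b + 3 * c)

lemma HasTop.mem {g : MvPolynomial (Fin 3) k} {u : k} {b c : ℕ} (h : HasTop g u b c) :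
    g ∈ weightLT k (b + 3 * c + 1) := by
  have h1 := mem_weightLT (Nat.lt_succ_self (b + 3 * c)) u 0
  rw [pow_zero, one_mul] at h1
  simpa using Submodule.add_mem _ (weightLT_mono (Nat.le_succ _) h) h1

lemma HasTop.mul {g g' : MvPolynomial (Fin 3) k} {u u' : k} {b b' c c' : ℕ} (h : HasTop g u b c)
    (h' : HasTop g' u' b' c') : HasTop (g * g') (u * u') (b + b') (c + c') := by
  have h1 := mem_weightLT (Nat.lt_succ_self (b + 3 * c)) u 0
  rw [pow_zero, one_mul] at h1
  have h2 := mul_mem_weightLT h h'.mem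
  have h3 := mul_mem_weightLT h' h1
  rw [HasTop, show b + b' + 3 * (c + c') = b + 3 * c + (b' + 3 * c') by ring]
  rw [add_comm (b' + 3 * c')] at h3
  convert Submodule.add_mem _ h2 h3 using 1
  rw [C_mul, pow_add, pow_add]
  ring

lemma hasTop_one : HasTop (1 : MvPolynomial (Fin 3) k) 1 0 0 := by
  simp [HasTop]

lemma HasTop.pow {g : MvPolynomial (Fin 3) k} {u : k} {b c : ℕ} (h : HasTop g u b c) (n : ℕ) :
    HasTop (g ^ n) (u ^ n) (n * b) (n * c) := by
  induction n with
  | zero => simpa using hasTop_one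
  | succ n ih =>
    rw [pow_succ, pow_succ, Nat.succ_mul, Nat.succ_mul]
    exact ih.mul h

lemma HasTop.prod {ι : Type*} (s : Finset ι) {g : ι → MvPolynomial (Fin 3) k} {u : k} {b c : ℕ}
    (h : ∀ i ∈ s, HasTop (g i) u b c) :
    HasTop (∏ i ∈ s, g i) (u ^ s.card) (s.card * b) (s.card * c) := by
  classical
  induction s using Finset.induction_on with
  | empty => simpa using hasTop_one
  | insert i s hi ih =>
    rw [Finset.prod_insert hi, Finset.card_insert_of_notMem hi, pow_succ', Nat.succ_mul,
      Nat.succ_mul, add_comm _ b, add_comm _ c]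
    exact (h i (Finset.mem_insert_self i s)).mul
      (ih fun j hj => h j (Finset.mem_insert_of_mem hj))

lemma HasTop.add {g g' : MvPolynomial (Fin 3) k} {u : k} {b c : ℕ} (h : HasTop g u b c)
    (h' : g' ∈ weightLT k (b + 3 * c)) : HasTop (g + g') u b c := by
  rw [HasTop, add_sub_right_comm]
  exact Submodule.add_mem _ h h'

lemma HasTop.C_mul {g : MvPolynomial (Fin 3) k} {u : k} {b c : ℕ} (h : HasTop g u b c) (v : k) :
    HasTop (C v * g) (v * u) b c := by
  have := Submodule.smul_mem _ v h
  rwa [smul_eq_C_mul, mul_sub, ← mul_assoc, ← MvPolynomial.C_mul] at this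

lemma hasTop_X_one_pow_mul_del_pow (b c : ℕ) :
    HasTop (X 1 ^ b * del ^ c : MvPolynomial (Fin 3) k) 1 b c := by
  simp [HasTop]

lemma X_two_pow_mul_mem_weightLT {n : ℕ} {g : MvPolynomial (Fin 3) k} (hg : g ∈ weightLT k n)
    (m : ℕ) : X 2 ^ m * g ∈ weightLT k n := by
  have h : (X 2 ^ m : MvPolynomial (Fin 3) k) ∈ weightLT k (0 + 1) := by
    have := mem_weightLT (show 0 + 3 * 0 < 0 + 1 by omega) (1 : k) m
    rwa [C_1, one_mul, pow_zero, pow_zero, mul_one, mul_one] at this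
  have := mul_mem_weightLT hg h
  rwa [add_zero, mul_comm] at this

lemma hasTop_f₁ (hp : 2 < p) : HasTop (f₁ p M) (-gam p M 0 1 2) 0 p := by
  have h1 := mem_weightLT (show p + 3 * 0 < 0 + 3 * p by omega) (-gam p M 0 1 3) p
  have h2 := mem_weightLT (show 0 + 3 * 1 < 0 + 3 * p by omega) (-gam p M 0 2 3) (2 * p - 2)
  have h3 := mem_weightLT (show 1 + 3 * 0 < 0 + 3 * p by omega) (-gam p M 1 2 3) (2 * p - 1)
  have := Submodule.add_mem _ (Submodule.add_mem _ h1 h2) h3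
  rw [HasTop]
  convert this using 1
  rw [f₁]
  simp only [map_neg]
  ring

lemma hasTop_f₂ (hp : 2 < p) : HasTop (f₂ p M) (gam p M 0 1 2) (p ^ 2) 0 := by
  have hlt : p < p ^ 2 := by nlinarith
  have hlt' : 3 * p ≤ p ^ 2 := by nlinarith
  have h1 := mem_weightLT (show p + 3 * 0 < p ^ 2 + 3 * 0 by omega) (-gam p M 0 1 4) (p ^ 2 - p)
  have h2 := mem_weightLT (show 0 + 3 * 1 < p ^ 2 + 3 * 0 by omega) (-gam p M 0 2 4) (p ^ 2 - 2)
  have h3 := mem_weightLT (show 1 + 3 * 0 < p ^ 2 + 3 * 0 by omega) (-gam p M 1 2 4) (p ^ 2 - 1)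
  have := Submodule.add_mem _ (Submodule.add_mem _ h1 h2) h3
  rw [HasTop]
  convert this using 1
  rw [f₂]
  simp only [map_neg]
  ring

/-- Weight 3 for δ, instead of its degree 2, makes f₁^p of weight 3p² dominate f₂² of weight 2p², so
the cancellation seen modulo x does not affect the top term. -/
lemma hasTop_f₃num (hp : 2 < p) : HasTop (f₃num p M) ((-gam p M 0 1 2) ^ p) 0 (p ^ 2) := by
  have hlt : p < p ^ 2 := by nlinarith
  have hf := hasTop_f₁ p M hp
  have h2 := ((hasTop_f₂ p M hp).pow 2).C_mul (gam p M 0 1 2 ^ (p - 2))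
  have h3 := ((hf.pow ((p + 1) / 2)).C_mul
    (2 * (-gam p M 0 1 2) ^ ((p - 3) / 2) * gam p M 0 1 4)).mem
  have h1 := hf.pow p
  rw [mul_zero, ← pow_two] at h1
  refine (h1.add (weightLT_mono ?_ h2.mem)).add ?_
  · omega
  · have h4 := X_two_pow_mul_mem_weightLT (weightLT_mono (n := 0 + 3 * p ^ 2) ?_ h3) (p ^ 2 - p)
    · convert h4 using 1
      ring
    · obtain ⟨r, hr⟩ := (Fact.out : p.Prime).odd_of_ne_two hp.ne'
      have hr' : (p + 1) / 2 = r + 1 := by omega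
      rw [hr', hr]
      nlinarith

lemma hasTop_f₃ (hp : 2 < p) :
    HasTop (X 2 ^ (p ^ 2 - 2) * f₃ p M) ((-2)⁻¹ * (-gam p M 0 1 2) ^ p) 0 (p ^ 2) := by
  convert (hasTop_f₃num p M hp).C_mul (-2)⁻¹ using 1
  have h2 := two_ne_zero_of_char (k := k) p hp
  have : C ((-2 : k)⁻¹) * (-2 : MvPolynomial (Fin 3) k) = 1 := by
    rw [show (-2 : MvPolynomial (Fin 3) k) = C (-2) by rw [C_neg, map_ofNat], ← MvPolynomial.C_mul,
      inv_mul_cancel₀ (neg_ne_zero.2 h2), C_1]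
  rw [f₃num_eq_mul_f₃ p M hp, ← mul_assoc, ← mul_assoc, this, one_mul]

/-- Each factor times x is xz + … = -δ + y² + …, and y² has weight 2 < 3. -/
lemma hasTop_orbitProd (hp : 2 < p) (hγ : gam p M 0 1 2 ≠ 0) :
    HasTop (X 2 ^ p ^ 3 * orbitProd (repOfMatrix p M) (X 0)) ((-1) ^ p ^ 3) 0 (p ^ 3) := by
  have hlin (a : Fin 3 → ZMod p) : HasTop (X 2 * shift p M a (X 0)) (-1) 0 1 := by
    have h1 := mem_weightLT (show 2 + 3 * 0 < 0 + 3 * 1 by omega) (1 : k) 0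
    have h2 := mem_weightLT (show 1 + 3 * 0 < 0 + 3 * 1 by omega) (2 * gamComb p M a 0) 1
    have h3 := mem_weightLT (show 0 + 3 * 0 < 0 + 3 * 1 by omega)
      (gamComb p M a 0 ^ 2 + gamComb p M a 1) 2
    have := Submodule.add_mem _ (Submodule.add_mem _ h1 h2) h3
    rw [HasTop]
    convert this using 1
    rw [shift_X_zero]
    simp only [del, C_neg, C_1]
    ring
  have := HasTop.prod Finset.univ fun a _ => hlin a
  rw [Finset.prod_mul_distrib, Finset.prod_const, Finset.card_univ, card_exponents, mul_zero,
    mul_one, ← orbitProd_eq_prod_shift p M hp hγ] at this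
  exact this

/-! ### Standard expressions -/

/-- The span of the standard monomials in the generators. -/
def standardSpan : Submodule k (MvPolynomial (Fin 3) k) :=
  (restrictSupport k (standardExponents p)).map (aeval (gens p M)).toLinearMap

lemma mem_standardSpan {g : MvPolynomial (Fin 3) k} : g ∈ standardSpan p M ↔
    ∃ P : MvPolynomial (Fin 5) k, (∀ I ∈ P.support, I ∈ standardExponents p) ∧
      aeval (gens p M) P = g := by
  simp only [standardSpan, Submodule.mem_map, mem_restrictSupport_iff]
  rfl

lemma standardSpan_le_invariants (hp : 2 < p) (hγ : gam p M 0 1 2 ≠ 0) :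
    standardSpan p M ≤ Subalgebra.toSubmodule (invariants (repOfMatrix p M)) := by
  intro g hg
  obtain ⟨P, -, rfl⟩ := (mem_standardSpan p M).1 hg
  refine (?_ : (aeval (gens p M)).range ≤ invariants (repOfMatrix p M)) ⟨P, rfl⟩
  rw [← Algebra.adjoin_range_eq_range_aeval]
  refine Algebra.adjoin_le ?_
  rintro _ ⟨i, rfl⟩
  exact gens_mem_invariants p M hp hγ i

lemma X_two_pow_mul_mem_standardSpan {g : MvPolynomial (Fin 3) k} (hg : g ∈ standardSpan p M)
    (m : ℕ) : X 2 ^ m * g ∈ standardSpan p M := by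
  obtain ⟨P, hP, rfl⟩ := (mem_standardSpan p M).1 hg
  refine (mem_standardSpan p M).2 ⟨X 0 ^ m * P, fun I hI => ?_, by simp [gens]⟩
  rw [mem_support_iff, X_pow_eq_monomial, coeff_monomial_mul'] at hI
  split_ifs at hI with h
  · have := hP (I - Finsupp.single 0 m) (mem_support_iff.2 (by simpa using hI))
    simpa [standardExponents] using this
  · exact absurd rfl hI

/-- The polynomials that become combinations of the `y^b δ^c`, `b < p²`, `c < p`, with coefficients in
the span of the standard monomials after multiplication by a power of `x`. -/
def localStandard : Submodule k (MvPolynomial (Fin 3) k) where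
  carrier := {g | ∃ (m : ℕ) (e : Fin (p ^ 2) × Fin p → MvPolynomial (Fin 3) k),
    (∀ b, e b ∈ standardSpan p M) ∧ X 2 ^ m * g = ∑ b, e b * (X 1 ^ b.1.1 * del ^ b.2.1)}
  zero_mem' := ⟨0, 0, fun _ => Submodule.zero_mem _, by simp⟩
  add_mem' := by
    rintro g g' ⟨m, e, he, h⟩ ⟨m', e', he', h'⟩
    refine ⟨m + m', fun b => X 2 ^ m' * e b + X 2 ^ m * e' b, fun b => Submodule.add_mem _
      (X_two_pow_mul_mem_standardSpan p M (he b) _)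
      (X_two_pow_mul_mem_standardSpan p M (he' b) _), ?_⟩
    simp only [add_mul, Finset.sum_add_distrib, mul_assoc, ← Finset.mul_sum]
    rw [← h, ← h', pow_add]
    ring
  smul_mem' := by
    rintro c g ⟨m, e, he, h⟩
    refine ⟨m, fun b => c • e b, fun b => Submodule.smul_mem _ _ (he b), ?_⟩
    simp only [smul_mul_assoc, ← Finset.smul_sum, mul_smul_comm, h]

lemma mem_localStandard_of_X_two_pow_mul {g : MvPolynomial (Fin 3) k} (m : ℕ)
    (h : X 2 ^ m * g ∈ localStandard p M) : g ∈ localStandard p M := by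
  obtain ⟨l, e, he, hg⟩ := h
  exact ⟨l + m, e, he, by rw [← hg, pow_add, mul_assoc]⟩

lemma X_two_pow_mul_mem_localStandard {g : MvPolynomial (Fin 3) k} (m : ℕ)
    (h : g ∈ localStandard p M) : X 2 ^ m * g ∈ localStandard p M := by
  obtain ⟨l, e, he, hg⟩ := h
  refine ⟨l, fun b => X 2 ^ m * e b, fun b => X_two_pow_mul_mem_standardSpan p M (he b) m, ?_⟩
  simp only [mul_assoc, ← Finset.mul_sum, ← hg]
  ring

lemma mul_mem_localStandard {g : MvPolynomial (Fin 3) k} (hg : g ∈ standardSpan p M) {b c : ℕ}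
    (hb : b < p ^ 2) (hc : c < p) : g * (X 1 ^ b * del ^ c) ∈ localStandard p M := by
  classical
  refine ⟨0, Pi.single (⟨b, hb⟩, ⟨c, hc⟩) g, fun i => ?_, ?_⟩
  · rcases eq_or_ne i (⟨b, hb⟩, ⟨c, hc⟩) with rfl | hi
    · simpa using hg
    · rw [Pi.single_eq_of_ne hi]
      exact Submodule.zero_mem _
  · rw [Finset.sum_eq_single (⟨b, hb⟩, ⟨c, hc⟩)]
    · simp
    · intro i _ hi
      rw [Pi.single_eq_of_ne hi, zero_mul]
    · simp

lemma exists_hasTop (hp : 2 < p) (hγ : gam p M 0 1 2 ≠ 0) (b c : ℕ) :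
    ∃ g ∈ localStandard p M, ∃ u : k, u ≠ 0 ∧ HasTop g u b c := by
  have hp0 : 0 < p := by omega
  -- The base-p expansion c = c₀ + i p + j p² + l p³ uses f₁, f₃, N_G(z) for the digits i, j and the
  -- rest l. The digits i and j are below p, so the product is standard.
  set i := c / p % p
  set j := c / p / p % p
  set l := c / p / p / p
  have h1 := (hasTop_f₁ p M hp).pow i
  have h2 := (hasTop_f₂ p M hp).pow (b / p ^ 2)
  have h3 := (hasTop_f₃ p M hp).pow j
  have h4 := (hasTop_orbitProd p M hp hγ).pow l
  have h5 := hasTop_X_one_pow_mul_del_pow (k := k) (b % p ^ 2) (c % p)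
  have h := (((h1.mul h2).mul h3).mul h4).mul h5
  have e1 : i * 0 + b / p ^ 2 * p ^ 2 + j * 0 + l * 0 + b % p ^ 2 = b := by
    have := Nat.div_add_mod' b (p ^ 2)
    omega
  have e2 : i * p + b / p ^ 2 * 0 + j * p ^ 2 + l * p ^ 3 + c % p = c := by
    have a1 := Nat.div_add_mod' c p
    have a2 := Nat.div_add_mod' (c / p) p
    have a3 := Nat.div_add_mod' (c / p / p) p
    change l * p + j = c / p / p at a3
    change c / p / p * p + i = c / p at a2
    rw [← a2, ← a3] at a1
    linarith
  rw [e1, e2] at h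
  refine ⟨_, ?_, _, ?_, h⟩
  · have hstd : f₁ p M ^ i * f₂ p M ^ (b / p ^ 2) * f₃ p M ^ j *
        orbitProd (repOfMatrix p M) (X 0) ^ l ∈ standardSpan p M := by
      refine (mem_standardSpan p M).2 ⟨monomial (Finsupp.equivFunOnFinite.symm
        ![0, i, b / p ^ 2, j, l]) 1, fun I hI => ?_, ?_⟩
      · rw [Finset.mem_singleton.1 (support_monomial_subset hI)]
        exact ⟨Nat.mod_lt _ hp0, Nat.mod_lt _ hp0⟩
      · rw [aeval_monomial, map_one, one_mul, Finsupp.prod_fintype _ _ (by simp)]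
        simp [Fin.prod_univ_five, gens]
    -- This exponent collects the powers of x attached to f₃ and N_G(z) in `hasTop_f₃` and
    -- `hasTop_orbitProd`.
    have := X_two_pow_mul_mem_localStandard p M ((p ^ 2 - 2) * j + p ^ 3 * l)
      (mul_mem_localStandard p M hstd (Nat.mod_lt b (pow_pos hp0 2)) (Nat.mod_lt c hp0))
    convert this using 1
    rw [mul_pow, mul_pow, ← pow_mul, ← pow_mul, pow_add]
    ring
  · have h2 := two_ne_zero_of_char (k := k) p hp
    simp [hγ, h2]

/-- Division algorithm by induction on the weight: subtracting an element of `localStandard` with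
the same top term leaves something of smaller weight. -/
lemma weightLT_le_localStandard (hp : 2 < p) (hγ : gam p M 0 1 2 ≠ 0) (n : ℕ) :
    weightLT k n ≤ localStandard p M := by
  induction n with
  | zero =>
    refine Submodule.span_le.2 ?_
    rintro _ ⟨m, b, c, h, -⟩
    exact absurd h (Nat.not_lt_zero _)
  | succ n ih =>
    refine Submodule.span_le.2 ?_
    rintro _ ⟨m, b, c, h, rfl⟩
    refine X_two_pow_mul_mem_localStandard p M m ?_
    obtain ⟨g, hg, u, hu, htop⟩ := exists_hasTop p M hp hγ b c
    have h1 := Submodule.sub_mem _ hg (ih (weightLT_mono (Nat.lt_succ_iff.1 h) htop))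
    rw [sub_sub_cancel, ← smul_eq_C_mul] at h1
    exact (Submodule.smul_mem_iff _ hu).1 h1

lemma exists_X_two_pow_mul_mem_weightLT (g : MvPolynomial (Fin 3) k) :
    ∃ m n : ℕ, X 2 ^ m * g ∈ weightLT k n := by
  have mulX {g : MvPolynomial (Fin 3) k} {h : MvPolynomial (Fin 3) k} {n l : ℕ}
      (hh : X 2 ^ l * h ∈ weightLT k (n + 1)) (hg : ∃ m n : ℕ, X 2 ^ m * g ∈ weightLT k n) :
      ∃ m n : ℕ, X 2 ^ m * (g * h) ∈ weightLT k n := by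
    obtain ⟨m, n', hg⟩ := hg
    refine ⟨m + l, n' + n, ?_⟩
    convert mul_mem_weightLT hg hh using 1
    rw [pow_add]
    ring
  induction g using MvPolynomial.induction_on with
  | C a =>
    refine ⟨0, 1, ?_⟩
    simpa using mem_weightLT (b := 0) (c := 0) one_pos a 0
  | add f g hf hg =>
    obtain ⟨m, n, hf⟩ := hf
    obtain ⟨m', n', hg⟩ := hg
    refine ⟨m + m', n + n', ?_⟩
    rw [mul_add]
    refine Submodule.add_mem _ (weightLT_mono (Nat.le_add_right _ _) ?_)
      (weightLT_mono (Nat.le_add_left _ _) ?_)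
    · rw [add_comm, pow_add, mul_assoc]
      exact X_two_pow_mul_mem_weightLT hf _
    · rw [pow_add, mul_assoc]
      exact X_two_pow_mul_mem_weightLT hg _
  | mul_X g i hg =>
    fin_cases i
    -- After one factor x, the variable z becomes xz = y² - δ, of weight at most 3.
    · refine mulX (l := 1) (n := 3) ?_ hg
      have h1 := mem_weightLT (show 2 + 3 * 0 < 3 + 1 by omega) (1 : k) 0
      have h2 := mem_weightLT (show 0 + 3 * 1 < 3 + 1 by omega) (1 : k) 0
      convert Submodule.sub_mem _ h1 h2 using 1
      simp only [del, C_1, Fin.zero_eta]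
      ring
    · refine mulX (l := 0) (n := 1) ?_ hg
      simpa using mem_weightLT (b := 1) (c := 0) one_lt_two (1 : k) 0
    · refine mulX (l := 0) (n := 0) ?_ hg
      simpa using mem_weightLT (b := 0) (c := 0) one_pos (1 : k) 1

lemma mem_localStandard (hp : 2 < p) (hγ : gam p M 0 1 2 ≠ 0) (g : MvPolynomial (Fin 3) k) :
    g ∈ localStandard p M := by
  obtain ⟨m, n, h⟩ := exists_X_two_pow_mul_mem_weightLT g
  exact mem_localStandard_of_X_two_pow_mul p M m (weightLT_le_localStandard p M hp hγ n h)

/-! ### Invariants are standard -/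

/-- The coefficients in S are invariant, so a relation among translations that holds on the products
y^b δ^c extends to all polynomials, up to a cancellable power of x. Distinct translations are
independent by Dedekind's theorem. -/
lemma eq_zero_of_sum_mul_shift_eq_zero (hp : 2 < p) (hγ : gam p M 0 1 2 ≠ 0)
    {v : (Fin 3 → ZMod p) → MvPolynomial (Fin 3) k}
    (hv : ∀ (b : Fin (p ^ 2)) (c : Fin p), ∑ a, v a * shift p M a (X 1 ^ b.1 * del ^ c.1) = 0) :
    v = 0 := by
  have key (g : MvPolynomial (Fin 3) k) : ∑ a, v a * shift p M a g = 0 := by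
    obtain ⟨m, e, he, h⟩ := mem_localStandard p M hp hγ g
    refine (mul_eq_zero.1 ?_).resolve_left (pow_ne_zero m (X_ne_zero (R := k) (2 : Fin 3)))
    have hinv (a : Fin 3 → ZMod p) : X 2 ^ m * shift p M a g =
        ∑ b, e b * shift p M a (X 1 ^ b.1.1 * del ^ b.2.1) := by
      rw [← shift_X_two p M a, ← map_pow, ← map_mul, h, map_sum]
      refine Finset.sum_congr rfl fun b _ => ?_
      rw [map_mul, (mem_invariants_iff_shift p M _).1
        (standardSpan_le_invariants p M hp hγ (he b)) a]
    calc X 2 ^ m * ∑ a, v a * shift p M a g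
        = ∑ a, ∑ b, e b * (v a * shift p M a (X 1 ^ b.1.1 * del ^ b.2.1)) := by
          rw [Finset.mul_sum]
          refine Finset.sum_congr rfl fun a _ => ?_
          rw [mul_left_comm, hinv, Finset.mul_sum]
          exact Finset.sum_congr rfl fun b _ => mul_left_comm _ _ _
      _ = 0 := by
          rw [Finset.sum_comm]
          refine Finset.sum_eq_zero fun b _ => ?_
          rw [← Finset.mul_sum, hv, mul_zero]
  have hinj : Function.Injective fun a : Fin 3 → ZMod p =>
      ((shift p M a : MvPolynomial (Fin 3) k →* MvPolynomial (Fin 3) k)) := fun a b h =>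
    shift_X_zero_injective p M hp hγ (DFunLike.congr_fun h (X 0))
  have hli := (linearIndependent_monoidHom (MvPolynomial (Fin 3) k) (MvPolynomial (Fin 3) k)).comp
    _ hinj
  funext a
  refine Fintype.linearIndependent_iff.1 hli v ?_ a
  funext g
  simpa using key g

lemma exists_X_two_pow_mul_mem_standardSpan (hp : 2 < p) (hγ : gam p M 0 1 2 ≠ 0)
    {f : MvPolynomial (Fin 3) k} (hf : f ∈ invariants (repOfMatrix p M)) :
    ∃ m : ℕ, X 2 ^ m * f ∈ standardSpan p M := by
  classical
  have hp0 : 0 < p := by omega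
  have hcard : Fintype.card (Fin (p ^ 2) × Fin p) = Fintype.card (Fin 3 → ZMod p) := by
    rw [card_exponents]
    simp
    ring
  set ε := Fintype.equivOfCardEq hcard
  set A : Matrix (Fin 3 → ZMod p) (Fin 3 → ZMod p) (MvPolynomial (Fin 3) k) :=
    Matrix.of fun a w => shift p M a (X 1 ^ (ε.symm w).1.1 * del ^ (ε.symm w).2.1) with hA
  have hdet : A.det ≠ 0 := by
    intro h
    obtain ⟨v, hv0, hv⟩ := Matrix.exists_vecMul_eq_zero_iff.2 h
    refine hv0 (eq_zero_of_sum_mul_shift_eq_zero p M hp hγ fun b c => ?_)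
    have := congrFun hv (ε (b, c))
    simpa [A, Matrix.vecMul, dotProduct] using this
  obtain ⟨m, e, he, h⟩ := mem_localStandard p M hp hγ f
  refine ⟨m, ?_⟩
  -- The index of y⁰ δ⁰ = 1. An invariant x^m f has the second expansion x^m f · 1, and `v` is the
  -- difference of the two coefficient vectors; every group element annihilates it.
  set o : Fin (p ^ 2) × Fin p := (⟨0, pow_pos hp0 2⟩, ⟨0, hp0⟩)
  set v : Fin (p ^ 2) × Fin p → MvPolynomial (Fin 3) k := e - Pi.single o (X 2 ^ m * f) with hv
  have hv0 : v ∘ ε.symm = 0 := by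
    refine Matrix.eq_zero_of_mulVec_eq_zero hdet ?_
    funext a
    have h1 := congrArg (shift p M a) h
    rw [map_mul, map_pow, shift_X_two, (mem_invariants_iff_shift p M _).1 hf a, map_sum] at h1
    have h2 : ∑ b, v b * shift p M a (X 1 ^ b.1.1 * del ^ b.2.1) = 0 := by
      have h3 : ∑ b, (Pi.single o (X 2 ^ m * f) : Fin (p ^ 2) × Fin p → MvPolynomial (Fin 3) k) b *
          shift p M a (X 1 ^ b.1.1 * del ^ b.2.1) = X 2 ^ m * f := by
        rw [Finset.sum_eq_single o]
        · simp only [Pi.single_eq_same, o, pow_zero, mul_one, map_one]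
        · intro b _ hb
          rw [Pi.single_eq_of_ne hb, zero_mul]
        · simp
      simp only [hv, Pi.sub_apply, sub_mul, Finset.sum_sub_distrib]
      rw [h3, h1, sub_eq_zero]
      refine Finset.sum_congr rfl fun b _ => ?_
      rw [map_mul _ (e b), (mem_invariants_iff_shift p M _).1
        (standardSpan_le_invariants p M hp hγ (he b)) a]
    rw [Pi.zero_apply, ← h2]
    exact Fintype.sum_equiv ε.symm _ _ fun w => mul_comm _ _
  have := congrFun hv0 (ε o)
  simp only [Function.comp_apply, Equiv.symm_apply_apply, hv, Pi.sub_apply, Pi.single_eq_same,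
    Pi.zero_apply, sub_eq_zero] at this
  exact this ▸ he o

lemma mem_standardSpan_of_X_two_pow_mul (hp : 2 < p) (hγ : gam p M 0 1 2 ≠ 0)
    (hη : gam p M 0 2 4 ≠ 0) {f : MvPolynomial (Fin 3) k} {m : ℕ}
    (h : X 2 ^ m * f ∈ standardSpan p M) : f ∈ standardSpan p M := by
  induction m with
  | zero => simpa using h
  | succ m ih =>
    refine ih ?_
    rw [pow_succ', mul_assoc] at h
    obtain ⟨P, hP, hPf⟩ := (mem_standardSpan p M).1 h
    exact (mem_standardSpan p M).2 (exists_standard_of_X_mul p M hp hγ hη hP hPf)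

/-- The ring of invariants is spanned by the standard monomials in the generators. -/
theorem invariants_eq_standardSpan (hp : 2 < p) (hγ : gam p M 0 1 2 ≠ 0)
    (hη : gam p M 0 2 4 ≠ 0) :
    Subalgebra.toSubmodule (invariants (repOfMatrix p M)) = standardSpan p M := by
  refine le_antisymm (fun f hf => ?_) (standardSpan_le_invariants p M hp hγ)
  obtain ⟨m, hm⟩ := exists_X_two_pow_mul_mem_standardSpan p M hp hγ hf
  exact mem_standardSpan_of_X_two_pow_mul p M hp hγ hη hm

end Division

/-! ### The relations -/

section Relations

set_option linter.unusedSectionVars false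

variable {k : Type*} [Field k] (p : ℕ) [Fact p.Prime] [Algebra (ZMod p) k] [CharP k p]
  (M : Matrix (Fin 2) (Fin 3) k)

lemma aeval_relOne (hp : 2 < p) : aeval (gens p M) (relOne p M) = 0 := by
  have h := f₃num_eq_mul_f₃ p M hp
  rw [f₃num] at h
  simp only [relOne, map_add, map_mul, map_pow, map_ofNat, aeval_X, aeval_C, algebraMap_eq, gens,
    Matrix.cons_val]
  simp only [map_mul, map_pow, map_ofNat] at h ⊢
  linear_combination h

lemma range_aeval_gens (hp : 2 < p) (hγ : gam p M 0 1 2 ≠ 0) (hη : gam p M 0 2 4 ≠ 0) :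
    (aeval (gens p M) : MvPolynomial (Fin 5) k →ₐ[k] _).range = invariants (repOfMatrix p M) := by
  refine le_antisymm ?_ fun f hf => ?_
  · rw [← Algebra.adjoin_range_eq_range_aeval]
    refine Algebra.adjoin_le ?_
    rintro _ ⟨i, rfl⟩
    exact gens_mem_invariants p M hp hγ i
  · have hf' : f ∈ standardSpan p M := by
      rw [← invariants_eq_standardSpan p M hp hγ hη]
      exact hf
    obtain ⟨P, -, hP⟩ := (mem_standardSpan p M).1 hf'
    exact ⟨P, hP⟩

lemma degree_aeval_gens_monomial (hp : 2 < p) (hγ : gam p M 0 1 2 ≠ 0) (hη : gam p M 0 2 4 ≠ 0)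
    (I : Fin 5 →₀ ℕ) {c : k} (hc : c ≠ 0) :
    grevlex.degree (aeval (gens p M) (monomial I c)) = leadExponent p I := by
  rw [degree_aeval_monomial (gens_ne_zero p M hp hγ hη) I hc]
  simp only [grevlex_degree_gens p M hp hγ hη]
  rfl

lemma exists_degree_aeval_gens_eq (hp : 2 < p) (hγ : gam p M 0 1 2 ≠ 0) (hη : gam p M 0 2 4 ≠ 0)
    {P : MvPolynomial (Fin 5) k} (hP : P ≠ 0) (hPS : ∀ I ∈ P.support, I ∈ standardExponents p) :
    aeval (gens p M) P ≠ 0 ∧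
      ∃ I ∈ P.support, grevlex.degree (aeval (gens p M) P) = leadExponent p I :=
  exists_degree_aeval_eq grevlex (leadExponent p)
    (fun I _ => aeval_monomial_ne_zero (gens_ne_zero p M hp hγ hη) I one_ne_zero)
    (fun I _ => degree_aeval_gens_monomial p M hp hγ hη I one_ne_zero)
    (injOn_leadExponent p hp) hP hPS

lemma exists_degree_eq_of_mem_invariants (hp : 2 < p) (hγ : gam p M 0 1 2 ≠ 0)
    (hη : gam p M 0 2 4 ≠ 0) {f : MvPolynomial (Fin 3) k}
    (hf : f ∈ invariants (repOfMatrix p M)) (hf0 : f ≠ 0) :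
    ∃ I : Fin 5 →₀ ℕ,
      grevlex.degree f = I.sum fun i n => n • grevlex.degree (gens p M i) := by
  have hf' : f ∈ standardSpan p M := by
    rw [← invariants_eq_standardSpan p M hp hγ hη]
    exact hf
  obtain ⟨P, hP, rfl⟩ := (mem_standardSpan p M).1 hf'
  have hP0 : P ≠ 0 := by
    rintro rfl
    exact hf0 (map_zero _)
  obtain ⟨-, I, -, hI⟩ := exists_degree_aeval_gens_eq p M hp hγ hη hP0 hP
  refine ⟨I, ?_⟩
  simp only [hI, grevlex_degree_gens p M hp hγ hη]
  rfl

/-- Modulo x both summands are multiples of y^(p³+2p), with opposite coefficients: (p² - 2p - 1) + 1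
+ p = p(p - 1) is the exponent of γ₁₂₃ in each. -/
lemma exists_aeval_teteATete_eq (hp : 2 < p) :
    ∃ A, aeval (gens p M) (teteATete p M) = X 2 * A := by
  obtain ⟨A₁, h₁⟩ := exists_f₁_eq_add p M hp
  obtain ⟨A₂, h₂⟩ := exists_f₂_eq_add p M hp
  obtain ⟨A₃, h₃⟩ := exists_f₃_eq_add p M hp
  have h : aeval (gens p M) (teteATete p M) = f₃ p M ^ p +
      C (gam p M 0 2 4 ^ p * gam p M 0 1 2 ^ (p ^ 2 - 2 * p - 1)) * f₁ p M * f₂ p M ^ p := by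
    simp [teteATete, gens]
  have hle : 3 * p ≤ p ^ 2 := by nlinarith
  obtain ⟨r, hr⟩ : ∃ r, p = r + 1 := ⟨p - 1, by omega⟩
  rw [h, h₁, h₂, h₃, add_pow_char, add_pow_char, mul_pow, mul_pow, mul_pow, mul_pow]
  set g : MvPolynomial (Fin 3) k := C (gam p M 0 1 2)
  set e : MvPolynomial (Fin 3) k := C (gam p M 0 2 4)
  set x : MvPolynomial (Fin 3) k := X 2
  set y : MvPolynomial (Fin 3) k := X 1
  have hx : x ^ p = x * x ^ r := by rw [← pow_succ', ← hr]
  have hy : (y ^ (p ^ 2 + 2)) ^ p = (y ^ p ^ 2) ^ p * y ^ (2 * p) := by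
    rw [pow_add, mul_pow, ← pow_mul y 2]
  have hg : (g ^ (p - 1)) ^ p = g ^ (p ^ 2 - 2 * p - 1) * g * g ^ p := by
    rw [← pow_mul, ← pow_succ, ← pow_add]
    congr 1
    rw [Nat.sub_one_mul, ← pow_two]
    omega
  refine ⟨x ^ r * A₃ ^ p + e ^ p * g ^ (p ^ 2 - 2 * p - 1) * (x ^ r * A₁ * (g ^ p * (y ^ p ^ 2) ^ p)
    + (-g * y ^ (2 * p) + x ^ p * A₁) * (x ^ r * A₂ ^ p)), ?_⟩
  simp only [map_mul, map_pow]
  change (g ^ (p - 1) * e) ^ p * _ + _ + e ^ p * g ^ _ * _ * _ = _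
  rw [mul_pow, hg, hy]
  linear_combination (A₃ ^ p + e ^ p * g ^ (p ^ 2 - 2 * p - 1) * A₁ * (g ^ p * (y ^ p ^ 2) ^ p)
    + e ^ p * g ^ (p ^ 2 - 2 * p - 1) * (-g * y ^ (2 * p) + x ^ p * A₁) * A₂ ^ p) * hx

lemma isHomogeneous_aeval_teteATete (hp : 2 < p) :
    (aeval (gens p M) (teteATete p M)).IsHomogeneous (p ^ 3 + 2 * p) := by
  have h : aeval (gens p M) (teteATete p M) = f₃ p M ^ p +
      C (gam p M 0 2 4 ^ p * gam p M 0 1 2 ^ (p ^ 2 - 2 * p - 1)) * f₁ p M * f₂ p M ^ p := by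
    simp [teteATete, gens]
  rw [h]
  refine IsHomogeneous.add (IsHomogeneous.of_eq ((isHomogeneous_f₃ p M hp).pow p) (by ring))
    (IsHomogeneous.of_eq (((isHomogeneous_C _ _).mul (isHomogeneous_f₁ p M hp)).mul
      ((isHomogeneous_f₂ p M hp).pow p)) (by ring))

/-- The monomials in a second relation that is obtained by subduction. -/
lemma SubductsToZero.support_lt (hp : 2 < p) (hγ : gam p M 0 1 2 ≠ 0) (hη : gam p M 0 2 4 ≠ 0)
    {q : MvPolynomial (Fin 5) k}
    (hq : SubductsToZero grevlex (gens p M) (aeval (gens p M) (teteATete p M)) q)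
    {I : Fin 5 →₀ ℕ} (hI : I ∈ q.support) :
    grevlex.toSyn (leadExponent p I) < grevlex.toSyn (leadExponent p (Finsupp.single 3 p)) := by
  set T := aeval (gens p M) (teteATete p M) with hT
  -- If the element were 0, the only subduction would be the empty one and `q` would have no terms.
  have hT0 : T ≠ 0 := by
    intro h0
    rw [h0] at hq
    cases hq with
    | zero => simp at hI
    | step _ _ _ _ hf => exact hf rfl
  have hle := hq.degree_le (gens_ne_zero p M hp hγ hη) hI
  simp only [grevlex_degree_gens p M hp hγ hη] at hle
  refine lt_of_le_of_lt hle ?_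
  have hdeg : coeff (grevlex.degree T) T ≠ 0 := MonomialOrder.coeff_degree_ne_zero_iff.2 hT0
  set d := grevlex.degree T
  have h1 : p ^ 3 + 2 * p = d 0 + d 1 + d 2 := by
    rw [(isHomogeneous_aeval_teteATete p M hp).degree_eq_sum_deg_support (mem_support_iff.2 hdeg),
      ← Fin.sum_univ_three]
    exact Finset.sum_subset (Finset.subset_univ _) fun i _ hi => Finsupp.notMem_support_iff.1 hi
  -- Divisibility by x puts x into the lead monomial, which makes it smaller than y^(p³+2p), the
  -- lead monomial of f₃^p, of the same degree.
  have h2 : d 2 ≠ 0 := by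
    obtain ⟨A, hA⟩ := exists_aeval_teteATete_eq p M hp
    rw [← hT] at hA
    intro h0
    rw [hA, coeff_X_mul', if_neg (fun h => Finsupp.mem_support_iff.1 h h0)] at hdeg
    exact hdeg rfl
  rw [grevlex_lt_iff, leadExponent_apply_zero, leadExponent_apply_one, leadExponent_apply_two]
  have e : p * (p ^ 2 + 2) = p ^ 3 + 2 * p := by ring
  simp [e]
  omega

lemma SubductsToZero.sum_genDegree (hp : 2 < p) (hγ : gam p M 0 1 2 ≠ 0)
    {q : MvPolynomial (Fin 5) k}
    (hq : SubductsToZero grevlex (gens p M) (aeval (gens p M) (teteATete p M)) q)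
    {I : Fin 5 →₀ ℕ} (hI : I ∈ q.support) : ∑ i, genDegree p i * I i = p ^ 3 + 2 * p := by
  rw [← hq.isHomogeneous (isHomogeneous_gens p M hp hγ) (isHomogeneous_aeval_teteATete p M hp) hI]
  exact (Finsupp.sum_fintype _ _ (by simp)).symm

/-! ### The ideal of relations -/

/-- The exponents of smaller lead monomial, or of equal lead monomial and smaller `I₁ + 2 I₃`. -/
def smallerExponents (J : Fin 5 →₀ ℕ) : Set (Fin 5 →₀ ℕ) :=
  {I | grevlex.toSyn (leadExponent p I) < grevlex.toSyn (leadExponent p J) ∨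
    leadExponent p I = leadExponent p J ∧ I 1 + 2 * I 3 < J 1 + 2 * J 3}

lemma add_mem_smallerExponents {I J : Fin 5 →₀ ℕ} (h : I ∈ smallerExponents p J)
    (K : Fin 5 →₀ ℕ) : I + K ∈ smallerExponents p (J + K) := by
  simp only [smallerExponents, Set.mem_ofPred_eq, leadExponent_add, map_add, Finsupp.add_apply] at h ⊢
  rcases h with h | ⟨h1, h2⟩
  · exact Or.inl (add_lt_add_left h _)
  · exact Or.inr ⟨by rw [h1], by omega⟩

/-- Lexicographic induction on the lead monomial and then on I₁ + 2 I₃. The second component is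
needed because the rewriting rules replace a monomial by one with the same lead monomial. -/
lemma monomial_mem_of_smaller {W : Submodule k (MvPolynomial (Fin 5) k)}
    (h : ∀ I, (∀ J ∈ smallerExponents p I, monomial J (1 : k) ∈ W) → monomial I (1 : k) ∈ W)
    (I : Fin 5 →₀ ℕ) : monomial I (1 : k) ∈ W := by
  induction hs : grevlex.toSyn (leadExponent p I) using WellFoundedLT.induction generalizing I with
  | ind s ihs =>
  induction hn : I 1 + 2 * I 3 using Nat.strong_induction_on generalizing I with
  | h n ihn =>
  refine h I fun J hJ => ?_
  rcases hJ with hJ | ⟨h1, h2⟩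
  · exact ihs _ (hs ▸ hJ) J rfl
  · exact ihn _ (hn ▸ h2) J (by rw [h1, hs]) rfl

lemma monomial_mem_of_reduction {J : Ideal (MvPolynomial (Fin 5) k)}
    {W : Submodule k (MvPolynomial (Fin 5) k)} (hJW : J.restrictScalars k ≤ W)
    {L I : Fin 5 →₀ ℕ} (hL : L ≤ I) {P : MvPolynomial (Fin 5) k}
    (hP : P ∈ restrictSupport k (smallerExponents p L)) (hLP : monomial L (1 : k) - P ∈ J)
    (hI : ∀ K ∈ smallerExponents p I, monomial K (1 : k) ∈ W) : monomial I (1 : k) ∈ W := by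
  obtain ⟨K, rfl⟩ := exists_add_of_le hL
  have h1 : (monomial L (1 : k) - P) * monomial K 1 ∈ W := hJW (J.mul_mem_right _ hLP)
  have h2 : P * monomial K 1 ∈ W := by
    rw [P.as_sum, Finset.sum_mul]
    refine Submodule.sum_mem _ fun N hN => ?_
    rw [monomial_mul, mul_one, ← mul_one (coeff N P), ← smul_eq_mul, ← smul_monomial]
    exact W.smul_mem _ (hI _ (add_mem_smallerExponents p ((mem_restrictSupport_iff k).1 hP hN) K))
  have h3 := W.add_mem h1 h2
  rwa [← add_mul, sub_add_cancel, monomial_mul, mul_one] at h3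

lemma monomial_sub_relOne_mem (hp : 2 < p) :
    monomial (Finsupp.single 1 p) 1 - relOne p M ∈
      restrictSupport k (smallerExponents p (Finsupp.single 1 p)) := by
  obtain ⟨r, hr⟩ := (Fact.out : p.Prime).odd_of_ne_two hp.ne'
  have hb : (p + 1) / 2 = r + 1 := by omega
  have hb' : (r + 1) * (2 * p) = p ^ 2 + p := by rw [hr]; ring
  have hle : 3 * p ≤ p ^ 2 := by nlinarith
  set c₁ := gam p M 0 1 2 ^ (p - 2) with hc₁
  set c₂ := 2 * (-gam p M 0 1 2) ^ ((p - 3) / 2) * gam p M 0 1 4 with hc₂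
  have h : monomial (Finsupp.single 1 p) 1 - relOne p M =
      -(monomial (Finsupp.single 2 2) c₁ +
        monomial (Finsupp.single 0 (p ^ 2 - p) + Finsupp.single 1 ((p + 1) / 2)) c₂ +
        monomial (Finsupp.single 0 (p ^ 2 - 2) + Finsupp.single 3 1) 2) := by
    have h2 : (2 : MvPolynomial (Fin 5) k) = C 2 := (map_ofNat C 2).symm
    rw [relOne, h2, ← hc₁, ← hc₂]
    simp only [X_pow_eq_monomial, C_mul_monomial, monomial_mul, mul_one]
    rw [X, monomial_mul, mul_one]
    abel
  rw [h]
  refine Submodule.neg_mem _ (Submodule.add_mem _ (Submodule.add_mem _ ?_ ?_) ?_)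
  -- X₁^p and X₂² share the lead monomial y^(2p²), so the tie-break is used: 0 < p.
  · refine (monomial_mem_restrictSupport k).2 (Or.inl (Or.inr ⟨?_, ?_⟩))
    · ext i
      fin_cases i
      · simp [leadExponent_apply_zero]
      · simp [leadExponent_apply_one]
        ring
      · simp [leadExponent_apply_two]
    · simp
      omega
  -- The remaining terms of R₁ have the same degree 2p² but involve x.
  · refine (monomial_mem_restrictSupport k).2 (Or.inl (Or.inl ?_))
    rw [grevlex_lt_iff]
    simp only [leadExponent_apply_zero, leadExponent_apply_one, leadExponent_apply_two, hb]
    simp [hb']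
    have : p * (2 * p) = 2 * p ^ 2 := by ring
    omega
  · refine (monomial_mem_restrictSupport k).2 (Or.inl (Or.inl ?_))
    rw [grevlex_lt_iff]
    simp only [leadExponent_apply_zero, leadExponent_apply_one, leadExponent_apply_two]
    simp
    have : p * (2 * p) = 2 * p ^ 2 := by ring
    omega

lemma teteATete_eq : teteATete p M = monomial (Finsupp.single 3 p) 1 +
    monomial (Finsupp.single 1 1 + Finsupp.single 2 p)
      (gam p M 0 2 4 ^ p * gam p M 0 1 2 ^ (p ^ 2 - 2 * p - 1)) := by
  rw [teteATete, X_pow_eq_monomial, X_pow_eq_monomial, X, C_mul_monomial, monomial_mul, mul_one,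
    mul_one]

lemma monomial_sub_teteATete_mem (hp : 2 < p) (hγ : gam p M 0 1 2 ≠ 0) (hη : gam p M 0 2 4 ≠ 0)
    {q : MvPolynomial (Fin 5) k}
    (hq : SubductsToZero grevlex (gens p M) (aeval (gens p M) (teteATete p M)) q) :
    monomial (Finsupp.single 3 p) 1 - (teteATete p M - q) ∈
      restrictSupport k (smallerExponents p (Finsupp.single 3 p)) := by
  set c := gam p M 0 2 4 ^ p * gam p M 0 1 2 ^ (p ^ 2 - 2 * p - 1) with hc
  have h : monomial (Finsupp.single 3 p) 1 - (teteATete p M - q) =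
      q - monomial (Finsupp.single 1 1 + Finsupp.single 2 p) c := by
    rw [teteATete_eq, ← hc]
    abel
  rw [h]
  refine Submodule.sub_mem _ ?_ ?_
  · exact (mem_restrictSupport_iff k).2 fun I hI => Or.inl (hq.support_lt p M hp hγ hη hI)
  -- X₃^p and X₁ X₂^p share the lead monomial y^(p³+2p); the tie-break is 1 < 2p.
  · refine (monomial_mem_restrictSupport k).2 (Or.inl (Or.inr ⟨?_, ?_⟩))
    · ext i
      fin_cases i
      · simp [leadExponent_apply_zero]
      · simp [leadExponent_apply_one]
        ring
      · simp [leadExponent_apply_two]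
    · simp
      omega

theorem ker_aeval_gens (hp : 2 < p) (hγ : gam p M 0 1 2 ≠ 0) (hη : gam p M 0 2 4 ≠ 0)
    {q : MvPolynomial (Fin 5) k}
    (hq : SubductsToZero grevlex (gens p M) (aeval (gens p M) (teteATete p M)) q) :
    RingHom.ker (aeval (R := k) (gens p M)) = Ideal.span {relOne p M, teteATete p M - q} := by
  set J : Ideal (MvPolynomial (Fin 5) k) := Ideal.span {relOne p M, teteATete p M - q} with hJ
  have h1 : relOne p M ∈ J := Ideal.subset_span (Or.inl rfl)
  have h2 : teteATete p M - q ∈ J := Ideal.subset_span (Or.inr rfl)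
  have hle : J ≤ RingHom.ker (aeval (R := k) (gens p M)) := by
    rw [hJ, Ideal.span_le]
    rintro _ (rfl | rfl)
    · exact aeval_relOne p M hp
    · change aeval (gens p M) (_ - _) = 0
      rw [map_sub, hq.aeval_eq, sub_self]
  refine le_antisymm (fun P hP => ?_) hle
  set W : Submodule k (MvPolynomial (Fin 5) k) :=
    restrictSupport k (standardExponents p) ⊔ J.restrictScalars k with hW
  have hJW : J.restrictScalars k ≤ W := le_sup_right
  have hmon := monomial_mem_of_smaller (k := k) p (W := W) fun I hI => by
    by_cases h3 : p ≤ I 3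
    · exact monomial_mem_of_reduction p hJW (Finsupp.single_le_iff.2 h3)
        (monomial_sub_teteATete_mem p M hp hγ hη hq) (by rwa [sub_sub_cancel]) hI
    by_cases h4 : p ≤ I 1
    · exact monomial_mem_of_reduction p hJW (Finsupp.single_le_iff.2 h4)
        (monomial_sub_relOne_mem p M hp) (by rwa [sub_sub_cancel]) hI
    · exact Submodule.mem_sup_left ((monomial_mem_restrictSupport k).2
        (Or.inl ⟨not_le.1 h4, not_le.1 h3⟩))
  have hPW : P ∈ W := by
    rw [P.as_sum]
    refine Submodule.sum_mem _ fun N _ => ?_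
    rw [← mul_one (coeff N P), ← smul_eq_mul, ← smul_monomial]
    exact W.smul_mem _ (hmon N)
  obtain ⟨Q, hQ, R, hR, rfl⟩ := Submodule.mem_sup.1 hPW
  have hR' : aeval (gens p M) R = 0 := hle hR
  -- The standard part of a relation is itself a relation, and standard monomials are independent.
  have hQ0 : Q = 0 := by
    by_contra hQ0
    refine (exists_degree_aeval_gens_eq p M hp hγ hη hQ0 fun I hI =>
      (mem_restrictSupport_iff k).1 hQ hI).1 ?_
    have hP' : aeval (gens p M) (Q + R) = 0 := hP
    rwa [map_add, hR', add_zero] at hP'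
  rw [hQ0, zero_add]
  exact hR

/-! ### Regularity of the relations and non-principality of the kernel -/

/-- R₁ is linear in X₃ with coefficient 2 X₀^(p²-2), and the part free of X₃ is not divisible by X₀
because it contains X₁^p. -/
lemma relOne_irreducible (hp : 2 < p) : Irreducible (relOne p M) := by
  have hle : 3 * p ≤ p ^ 2 := by nlinarith
  set g : MvPolynomial (Fin 5) k := X 1 ^ p + C (gam p M 0 1 2 ^ (p - 2)) * X 2 ^ 2
    + C (2 * (-gam p M 0 1 2) ^ ((p - 3) / 2) * gam p M 0 1 4)
      * X 0 ^ (p ^ 2 - p) * X 1 ^ ((p + 1) / 2) with hg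
  have h2 : (2 : MvPolynomial (Fin 5) k) = C 2 := (map_ofNat C 2).symm
  have hu : IsUnit (C 2 : MvPolynomial (Fin 5) k) :=
    (IsUnit.mk0 (2 : k) (two_ne_zero_of_char p hp)).map C
  have hrel : relOne p M = C 2 * X 0 ^ (p ^ 2 - 2) * X 3 + g := by
    rw [relOne, hg, h2]
    ring
  have hmem {f : MvPolynomial (Fin 5) k} (hf : f ∈ supported k ({3}ᶜ : Set (Fin 5))) :
      3 ∉ f.vars := fun h => (mem_supported.1 hf h) rfl
  have hX {i : Fin 5} (hi : i ≠ 3) : (X i : MvPolynomial (Fin 5) k) ∈ supported k ({3}ᶜ : Set _) :=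
    X_mem_supported.2 hi
  have hC (c : k) : (C c : MvPolynomial (Fin 5) k) ∈ supported k ({3}ᶜ : Set (Fin 5)) :=
    Subalgebra.algebraMap_mem _ c
  rw [hrel]
  refine irreducible_mul_X_add _ _ 3 (mul_ne_zero hu.ne_zero (pow_ne_zero _ (X_ne_zero 0)))
    (hmem (mul_mem (hC _) (pow_mem (hX (by decide)) _))) (hmem ?_) ?_
  · exact add_mem (add_mem (pow_mem (hX (by decide)) _) (mul_mem (hC _) (pow_mem (hX (by decide)) _)))
      (mul_mem (mul_mem (hC _) (pow_mem (hX (by decide)) _)) (pow_mem (hX (by decide)) _))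
  · refine IsRelPrime.mul_left hu.isRelPrime_left (IsRelPrime.pow_left ?_)
    refine ((X_prime (R := k)).irreducible.isRelPrime_iff_not_dvd).2 ?_
    rintro ⟨t, ht⟩
    have := congrArg (eval ![0, 1, 0, 0, 0]) ht
    have h0 : p ^ 2 - p ≠ 0 := by omega
    simp [hg, h0] at this

lemma relOne_mem_span_X (hp : 2 < p) :
    relOne p M ∈ Ideal.span (X '' ({0, 1, 2} : Set (Fin 5))) := by
  have hle : 3 * p ≤ p ^ 2 := by nlinarith
  have hX {i : Fin 5} (hi : i ∈ ({0, 1, 2} : Set (Fin 5))) {n : ℕ} (hn : 0 < n) :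
      (X i ^ n : MvPolynomial (Fin 5) k) ∈ Ideal.span (X '' ({0, 1, 2} : Set (Fin 5))) :=
    Ideal.pow_mem_of_mem _ (Ideal.subset_span (Set.mem_image_of_mem X hi)) n hn
  refine Ideal.add_mem _ (Ideal.add_mem _ (Ideal.add_mem _ ?_ ?_) ?_) ?_
  · exact hX (by simp) (by omega)
  · exact Ideal.mul_mem_left _ _ (hX (by simp) two_pos)
  · exact Ideal.mul_mem_left _ _ (hX (by simp) (by omega))
  · exact Ideal.mul_mem_right _ _ (Ideal.mul_mem_left _ _ (hX (by simp) (by omega)))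

/-- R₁ lies in the ideal (X₀, X₁, X₂), whereas R₂ contains X₃^p with coefficient 1: the terms of `q`
have smaller lead monomials and cannot cancel it. -/
lemma not_relOne_dvd (hp : 2 < p) (hγ : gam p M 0 1 2 ≠ 0) (hη : gam p M 0 2 4 ≠ 0)
    {q : MvPolynomial (Fin 5) k}
    (hq : SubductsToZero grevlex (gens p M) (aeval (gens p M) (teteATete p M)) q) :
    ¬ relOne p M ∣ teteATete p M - q := by
  classical
  intro h
  have hmem := Ideal.mem_of_dvd _ h (relOne_mem_span_X p M hp)
  have hq3 : coeff (Finsupp.single 3 p) q = 0 := by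
    by_contra h0
    exact lt_irrefl _ (hq.support_lt p M hp hγ hη (mem_support_iff.2 h0))
  have hne : (Finsupp.single 1 1 + Finsupp.single 2 p : Fin 5 →₀ ℕ) ≠ Finsupp.single 3 p :=
    fun h => by simpa using DFunLike.congr_fun h 1
  obtain ⟨i, hi, hi0⟩ := mem_ideal_span_X_image.1 hmem (Finsupp.single 3 p) (by
    rw [mem_support_iff, coeff_sub, hq3, teteATete_eq, coeff_add, coeff_monomial, coeff_monomial,
      if_pos rfl, if_neg hne]
    simp)
  rcases hi with rfl | rfl | rfl <;> simp at hi0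

theorem isRegular_relations (hp : 2 < p) (hγ : gam p M 0 1 2 ≠ 0) (hη : gam p M 0 2 4 ≠ 0)
    {q : MvPolynomial (Fin 5) k}
    (hq : SubductsToZero grevlex (gens p M) (aeval (gens p M) (teteATete p M)) q) :
    RingTheory.Sequence.IsRegular (MvPolynomial (Fin 5) k) [relOne p M, teteATete p M - q] := by
  have hprime := (relOne_irreducible p M hp).prime
  refine ⟨?_, ?_⟩
  · rw [RingTheory.Sequence.isWeaklyRegular_cons_iff,
      RingTheory.Sequence.isWeaklyRegular_singleton_iff]
    refine ⟨fun a b h => mul_left_cancel₀ hprime.ne_zero h, ?_⟩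
    refine (isSMulRegular_quotient_iff_mem_of_smul_mem _ _).2 fun x hx => ?_
    rw [Submodule.mem_smul_pointwise_iff_exists] at hx ⊢
    obtain ⟨b, -, hb⟩ := hx
    rcases hprime.dvd_or_dvd ⟨b, hb.symm⟩ with h | ⟨c, hc⟩
    · exact absurd h (not_relOne_dvd p M hp hγ hη hq)
    · exact ⟨c, trivial, hc.symm⟩
  · rw [smul_eq_mul, Ideal.mul_top, Ideal.ofList_cons, Ideal.ofList_singleton,
      ← Ideal.span_insert, ← ker_aeval_gens p M hp hγ hη hq]
    exact (RingHom.ker_ne_top _).symm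

/-- A single generator would divide the irreducible R₁ without being a unit, hence be associate to
R₁, and R₁ would divide R₂. -/
theorem not_isPrincipal_ker (hp : 2 < p) (hγ : gam p M 0 1 2 ≠ 0) (hη : gam p M 0 2 4 ≠ 0)
    {q : MvPolynomial (Fin 5) k}
    (hq : SubductsToZero grevlex (gens p M) (aeval (gens p M) (teteATete p M)) q) :
    ¬ (RingHom.ker (aeval (R := k) (gens p M))).IsPrincipal := by
  rintro ⟨d, hd⟩
  have h1 : relOne p M ∈ RingHom.ker (aeval (R := k) (gens p M)) := aeval_relOne p M hp
  have h2 : teteATete p M - q ∈ RingHom.ker (aeval (R := k) (gens p M)) := by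
    rw [ker_aeval_gens p M hp hγ hη hq]
    exact Ideal.subset_span (Or.inr rfl)
  have hd0 : ¬ IsUnit d := fun hu => RingHom.ker_ne_top (aeval (R := k) (gens p M))
    (hd.trans (Ideal.span_singleton_eq_top.2 hu))
  rw [hd] at h1 h2
  obtain ⟨c, hc⟩ := Ideal.mem_span_singleton.1 h1
  have hcu := ((relOne_irreducible p M hp).isUnit_or_isUnit hc).resolve_left hd0
  refine not_relOne_dvd p M hp hγ hη hq (dvd_trans ?_ (Ideal.mem_span_singleton.1 h2))
  rw [hc, hcu.mul_right_dvd]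

/-! ### The embedding dimension -/

lemma X_pow_mem_pow_idealOfVars (i : Fin 5) (n : ℕ) :
    (X i ^ n : MvPolynomial (Fin 5) k) ∈ idealOfVars (Fin 5) k ^ n :=
  Ideal.pow_mem_pow (Ideal.subset_span (Set.mem_range_self i)) n

lemma ker_aeval_gens_le (hp : 2 < p) (hγ : gam p M 0 1 2 ≠ 0) (hη : gam p M 0 2 4 ≠ 0)
    {q : MvPolynomial (Fin 5) k}
    (hq : SubductsToZero grevlex (gens p M) (aeval (gens p M) (teteATete p M)) q) :
    RingHom.ker (aeval (R := k) (gens p M)) ≤ idealOfVars (Fin 5) k ^ 2 := by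
  have hle : 3 * p ≤ p ^ 2 := by nlinarith
  have hle' : 3 * p ^ 2 ≤ p ^ 3 := by nlinarith
  have hX (i : Fin 5) {n : ℕ} (hn : 2 ≤ n) :
      (X i ^ n : MvPolynomial (Fin 5) k) ∈ idealOfVars (Fin 5) k ^ 2 :=
    Ideal.pow_le_pow_right hn (X_pow_mem_pow_idealOfVars i n)
  rw [ker_aeval_gens p M hp hγ hη hq, Ideal.span_le]
  rintro _ (rfl | rfl)
  · refine Ideal.add_mem _ (Ideal.add_mem _ (Ideal.add_mem _ ?_ ?_) ?_) ?_
    · exact hX 1 (by omega)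
    · exact Ideal.mul_mem_left _ _ (hX 2 le_rfl)
    · exact Ideal.mul_mem_left _ _ (hX 1 (by omega))
    · exact Ideal.mul_mem_right _ _ (Ideal.mul_mem_left _ _ (hX 0 (by omega)))
  · refine Ideal.sub_mem _ (Ideal.add_mem _ (hX 3 (by omega)) (Ideal.mul_mem_left _ _
      (hX 2 (by omega)))) ((mem_pow_idealOfVars_iff 2 q).2 fun I hI => ?_)
    have h := hq.sum_genDegree p M hp hγ hI
    by_contra hlt
    -- A constant or linear term of `q` would have weighted degree at most p³, but all its terms
    -- have degree p³ + 2p.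
    have hbound (i : Fin 5) : genDegree p i ≤ p ^ 3 := by
      fin_cases i <;> simp [genDegree] <;> omega
    have : ∑ i, genDegree p i * I i ≤ p ^ 3 * 1 := by
      refine (Finset.sum_le_sum fun i _ => Nat.mul_le_mul_right (I i) (hbound i)).trans ?_
      rw [← Finset.mul_sum, ← Finsupp.degree_eq_sum]
      exact Nat.mul_le_mul_left _ (by omega)
    omega

lemma constantCoeff_gens (hp : 2 < p) (hγ : gam p M 0 1 2 ≠ 0) (i : Fin 5) :
    constantCoeff (gens p M i) = 0 := by
  rw [constantCoeff_eq]
  refine (isHomogeneous_gens p M hp hγ i).coeff_eq_zero ?_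
  have : p ≠ 0 := by omega
  fin_cases i <;> simp [genDegree, this, (pow_ne_zero _ this).symm]

lemma constantCoeff_aeval_gens (hp : 2 < p) (hγ : gam p M 0 1 2 ≠ 0) (P : MvPolynomial (Fin 5) k) :
    constantCoeff (aeval (gens p M) P) = constantCoeff P := by
  induction P using MvPolynomial.induction_on with
  | C a => simp
  | add f g hf hg => rw [map_add, map_add, map_add, hf, hg]
  | mul_X f i hf => rw [map_mul, aeval_X, map_mul, map_mul, constantCoeff_gens p M hp hγ]; simp

lemma mem_idealOfVars_iff {σ : Type*} {P : MvPolynomial σ k} :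
    P ∈ idealOfVars σ k ↔ constantCoeff P = 0 := by
  rw [← pow_one (idealOfVars σ k), mem_pow_idealOfVars_iff', constantCoeff_eq]
  refine ⟨fun h => h 0 (by simp), fun h x hx => ?_⟩
  rw [(Finsupp.degree_eq_zero_iff x).1 (by omega), h]

/-- If an algebra is presented with `n` generators in the ideal `𝔪` and no relations with linear
terms, then `𝔪 / 𝔪²` has dimension `n`. -/
lemma finrank_cotangent_of_surjective {n : ℕ} {A : Type*} [CommRing A] [Algebra k A] (𝔪 : Ideal A)
    (π : MvPolynomial (Fin n) k →ₐ[k] A) (hsurj : Function.Surjective π)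
    (hmem : ∀ P, π P ∈ 𝔪 ↔ P ∈ idealOfVars (Fin n) k)
    (hker : RingHom.ker π ≤ idealOfVars (Fin n) k ^ 2) :
    Module.finrank k 𝔪.Cotangent = n := by
  have hmap : 𝔪 = (idealOfVars (Fin n) k).map π := by
    refine le_antisymm (fun a ha => ?_) (Ideal.map_le_iff_le_comap.2 fun P hP => (hmem P).2 hP)
    obtain ⟨P, rfl⟩ := hsurj a
    exact Ideal.mem_map_of_mem π ((hmem P).1 ha)
  have hsq : 𝔪 ^ 2 = (idealOfVars (Fin n) k ^ 2).map π := by rw [hmap, Ideal.map_pow]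
  -- Since the kernel lies in the square of the ideal of variables, 𝔪/𝔪² is the space of linear
  -- forms, with the classes of the variables as basis.
  have hsq' (P : MvPolynomial (Fin n) k) : π P ∈ 𝔪 ^ 2 ↔ P ∈ idealOfVars (Fin n) k ^ 2 := by
    refine ⟨fun h => ?_, fun h => hsq ▸ Ideal.mem_map_of_mem π h⟩
    rw [hsq] at h
    obtain ⟨Q, hQ, hPQ⟩ := (Ideal.mem_map_iff_of_surjective π hsurj).1 h
    have hPQ' : P - Q ∈ RingHom.ker π := by
      rw [RingHom.mem_ker, map_sub, hPQ, sub_self]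
    simpa using Ideal.add_mem _ (hker hPQ') hQ
  have hX (i : Fin n) : (X i : MvPolynomial (Fin n) k) ∈ idealOfVars (Fin n) k :=
    Ideal.subset_span (Set.mem_range_self i)
  have hlin (c : Fin n → k) :
      (∑ i, C (c i) * X i : MvPolynomial (Fin n) k) ∈ idealOfVars (Fin n) k :=
    Ideal.sum_mem _ fun i _ => Ideal.mul_mem_left _ _ (hX i)
  have hcoeff (c : Fin n → k) (i : Fin n) :
      coeff (Finsupp.single i 1) (∑ i, C (c i) * X i : MvPolynomial (Fin n) k) = c i := by
    simp [coeff_sum, coeff_C_mul, coeff_X, Finsupp.single_left_inj]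
  set v : Fin n → 𝔪.Cotangent := fun i => 𝔪.toCotangent ⟨π (X i), (hmem _).2 (hX i)⟩ with hv
  have hsum (c : Fin n → k) :
      ∑ i, c i • v i = 𝔪.toCotangent ⟨π (∑ i, C (c i) * X i), (hmem _).2 (hlin c)⟩ := by
    have : (⟨π (∑ i, C (c i) * X i), (hmem _).2 (hlin c)⟩ : 𝔪) =
        ∑ i, algebraMap k A (c i) • (⟨π (X i), (hmem _).2 (hX i)⟩ : 𝔪) := by
      apply Subtype.ext
      change π _ = _
      rw [map_sum, AddSubmonoidClass.coe_finsetSum]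
      refine Finset.sum_congr rfl fun i _ => ?_
      rw [map_mul, ← algebraMap_eq, AlgHom.commutes]
      rfl
    rw [this, map_sum]
    exact Finset.sum_congr rfl fun i _ => by rw [map_smul, algebraMap_smul]
  have hli : LinearIndependent k v := by
    rw [Fintype.linearIndependent_iff]
    intro c hc i
    rw [hsum c, Ideal.toCotangent_eq_zero, hsq', mem_pow_idealOfVars_iff'] at hc
    rw [← hcoeff c i, hc _ (by simp)]
  have hsp : ⊤ ≤ Submodule.span k (Set.range v) := by
    rintro a -
    obtain ⟨⟨a, ha⟩, rfl⟩ := 𝔪.toCotangent_surjective a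
    obtain ⟨P, rfl⟩ := hsurj a
    set c : Fin n → k := fun i => coeff (Finsupp.single i 1) P
    have : 𝔪.toCotangent ⟨π P, ha⟩ = ∑ i, c i • v i := by
      rw [hsum c, Ideal.toCotangent_eq]
      change π P - π _ ∈ _
      rw [← map_sub, hsq', mem_pow_idealOfVars_iff']
      intro x hx
      rw [coeff_sub, sub_eq_zero]
      rcases Nat.lt_succ_iff_lt_or_eq.1 hx with h0 | h1
      · rw [(Finsupp.degree_eq_zero_iff x).1 (by omega), ← constantCoeff_eq,
          mem_idealOfVars_iff.1 ((hmem _).1 ha), mem_idealOfVars_iff.1 (hlin c)]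
      · obtain ⟨i, hi⟩ := Finsupp.ne_iff.1 (show x ≠ 0 by rintro rfl; simp at h1)
        obtain ⟨y, rfl⟩ := exists_add_of_le
          (Finsupp.single_le_iff.2 (Nat.one_le_iff_ne_zero.2 hi) : Finsupp.single i 1 ≤ x)
        have hy : y = 0 := (Finsupp.degree_eq_zero_iff y).1 (by
          rw [map_add, Finsupp.degree_single] at h1
          omega)
        rw [hy, add_zero, hcoeff]
    rw [this]
    exact Submodule.sum_mem _ fun i _ =>
      Submodule.smul_mem _ _ (Submodule.subset_span (Set.mem_range_self i))
  have := Module.finrank_eq_card_basis (Module.Basis.mk hli hsp)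
  simpa using this

theorem embeddingDimension_invariants (hp : 2 < p) (hγ : gam p M 0 1 2 ≠ 0)
    (hη : gam p M 0 2 4 ≠ 0) {q : MvPolynomial (Fin 5) k}
    (hq : SubductsToZero grevlex (gens p M) (aeval (gens p M) (teteATete p M)) q) :
    embeddingDimension (invariants (repOfMatrix p M)) = 5 := by
  set A := invariants (repOfMatrix p M)
  set b : Fin 5 → A := fun i => ⟨gens p M i, gens_mem_invariants p M hp hγ i⟩
  have hb (P : MvPolynomial (Fin 5) k) :
      (aeval b P : MvPolynomial (Fin 3) k) = aeval (gens p M) P := by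
    change A.val (aeval b P) = _
    rw [← AlgHom.comp_apply, comp_aeval]
    rfl
  refine finrank_cotangent_of_surjective _ (aeval b) ?_ (fun P => ?_) fun P hP => ?_
  · rintro ⟨f, hf⟩
    obtain ⟨P, hP⟩ := (range_aeval_gens p M hp hγ hη).ge hf
    exact ⟨P, Subtype.ext ((hb P).trans hP)⟩
  · rw [mem_idealOfVars_iff, ← constantCoeff_aeval_gens p M hp hγ P, ← hb]
    rfl
  · refine ker_aeval_gens_le p M hp hγ hη hq ?_
    rw [RingHom.mem_ker, ← hb, RingHom.mem_ker.1 hP]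
    rfl

end Relations

/-! ### The minors of the generic matrix -/

section Generic

variable (p : ℕ) [Fact p.Prime]

lemma gam_genericMatrix_zero_one_two_ne_zero (hp : 2 < p) : gam p (genericMatrix p) 0 1 2 ≠ 0 := by
  set A : Matrix (Fin 3) (Fin 3) (MvPolynomial (Fin 2 × Fin 3) (ZMod p)) :=
    Matrix.of ![fun j => X (0, j), fun j => X (1, j), fun j => X (0, j) ^ p]
  have hA : gam p (genericMatrix p) 0 1 2 = algebraMap _ (GenericField p) A.det := by
    rw [gam, RingHom.map_det]
    congr 1
    ext i j
    fin_cases i <;> simp [A, Gam, genericMatrix]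
  rw [hA, Ne, FaithfulSMul.algebraMap_eq_zero_iff]
  intro h
  -- Under this specialization the determinant is X^p - X.
  have h' := congrArg (aeval fun ij : Fin 2 × Fin 3 =>
    (!![1, 0, Polynomial.X; 0, 1, 0] ij.1 ij.2 : Polynomial (ZMod p))) h
  rw [Matrix.det_fin_three, map_zero] at h'
  have hp0 : p ≠ 0 := by omega
  have h1 := congrArg (fun f => Polynomial.coeff f p) h'
  simp [A, hp0, Polynomial.coeff_X, Polynomial.coeff_X_pow, show 1 ≠ p by omega] at h1

lemma gam_genericMatrix_zero_two_four_ne_zero (hp : 2 < p) :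
    gam p (genericMatrix p) 0 2 4 ≠ 0 := by
  set A : Matrix (Fin 3) (Fin 3) (MvPolynomial (Fin 2 × Fin 3) (ZMod p)) :=
    Matrix.of ![fun j => X (0, j), fun j => X (0, j) ^ p, fun j => X (0, j) ^ p ^ 2]
  have hA : gam p (genericMatrix p) 0 2 4 = algebraMap _ (GenericField p) A.det := by
    rw [gam, RingHom.map_det]
    congr 1
    ext i j
    fin_cases i <;> simp [A, Gam, genericMatrix]
  rw [hA, Ne, FaithfulSMul.algebraMap_eq_zero_iff]
  intro h
  -- With x₁ⱼ ↦ 1, X, X² the diagonal term X^(p+2p²) of the determinant is not matched by any other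
  -- term.
  have h' := congrArg (aeval fun ij : Fin 2 × Fin 3 =>
    (Polynomial.X ^ ij.2.1 : Polynomial (ZMod p))) h
  rw [Matrix.det_fin_three, map_zero] at h'
  have hlt : 3 * p ≤ p ^ 2 := by nlinarith
  have h1 := congrArg (fun f => Polynomial.coeff f (p + 2 * p ^ 2)) h'
  simp only [A, Matrix.of_apply, Matrix.cons_val_zero, Matrix.cons_val_one, Matrix.cons_val,
    map_add, map_sub, map_mul, map_pow, aeval_X, ← pow_mul, ← pow_add, Polynomial.coeff_add,
    Polynomial.coeff_sub, Polynomial.coeff_X_pow, Polynomial.coeff_zero] at h1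
  simp at h1
  repeat rw [if_neg (by omega)] at h1
  simp at h1

end Generic

end ElemAbelian

end

/-! ### The generic representation -/

open ElemAbelian in
theorem mainTheorem10 (p : ℕ) [Fact p.Prime] (hp : 2 < p) :
    -- `{x, f₁, f₂, f₃, N_G(z)}` is a SAGBI basis of the ring of invariants
    ElemAbelian.IsSagbiBasis ElemAbelian.grevlex (Set.range (ElemAbelian.genericGens p))
      (ElemAbelian.invariants (ElemAbelian.genericRep p)) ∧
    -- and generates it
    (MvPolynomial.aeval (ElemAbelian.genericGens p) :
      MvPolynomial (Fin 5) (ElemAbelian.GenericField p) →ₐ[ElemAbelian.GenericField p] _).range =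
      ElemAbelian.invariants (ElemAbelian.genericRep p) ∧
    -- the explicit relation that defines `f₃`
    MvPolynomial.aeval (ElemAbelian.genericGens p)
      (ElemAbelian.relOne p (ElemAbelian.genericMatrix p)) = 0 ∧
    -- the other tête-à-tête is subducted to zero
    (∃ q, ElemAbelian.SubductsToZero ElemAbelian.grevlex (ElemAbelian.genericGens p)
      (MvPolynomial.aeval (ElemAbelian.genericGens p)
        (ElemAbelian.teteATete p (ElemAbelian.genericMatrix p))) q) ∧
    -- every such subduction gives the second relation: the two generate the ideal of relations and
    -- form a regular sequence
    (∀ q, ElemAbelian.SubductsToZero ElemAbelian.grevlex (ElemAbelian.genericGens p)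
      (MvPolynomial.aeval (ElemAbelian.genericGens p)
        (ElemAbelian.teteATete p (ElemAbelian.genericMatrix p))) q →
      RingHom.ker (MvPolynomial.aeval (R := ElemAbelian.GenericField p)
        (ElemAbelian.genericGens p)) =
        Ideal.span {ElemAbelian.relOne p (ElemAbelian.genericMatrix p),
          ElemAbelian.teteATete p (ElemAbelian.genericMatrix p) - q} ∧
      RingTheory.Sequence.IsRegular (MvPolynomial (Fin 5) (ElemAbelian.GenericField p))
        [ElemAbelian.relOne p (ElemAbelian.genericMatrix p),
          ElemAbelian.teteATete p (ElemAbelian.genericMatrix p) - q]) ∧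
    -- one relation does not suffice
    ¬ (RingHom.ker (MvPolynomial.aeval (R := ElemAbelian.GenericField p)
        (ElemAbelian.genericGens p))).IsPrincipal ∧
    ElemAbelian.embeddingDimension (ElemAbelian.invariants (ElemAbelian.genericRep p)) = 5 := by
  have : CharP (GenericField p) p :=
    charP_of_injective_algebraMap (algebraMap (ZMod p) (GenericField p)).injective p
  have hγ := gam_genericMatrix_zero_one_two_ne_zero p hp
  have hη := gam_genericMatrix_zero_two_four_ne_zero p hp
  set M := genericMatrix p
  have h0 := gens_ne_zero p M hp hγ hη
  have hinv := gens_mem_invariants p M hp hγ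
  have hdeg : ∀ f ∈ invariants (repOfMatrix p M), f ≠ 0 → _ :=
    fun f => exists_degree_eq_of_mem_invariants p M hp hγ hη
  have hrange := range_aeval_gens p M hp hγ hη
  obtain ⟨q, hq⟩ := exists_subductsToZero h0 hinv hdeg _
    (hrange.le ⟨teteATete p M, rfl⟩)
  exact ⟨isSagbiBasis_range h0 hinv hdeg, hrange, aeval_relOne p M hp, ⟨q, hq⟩,
    fun q hq => ⟨ker_aeval_gens p M hp hγ hη hq, isRegular_relations p M hp hγ hη hq⟩,
    not_isPrincipal_ker p M hp hγ hη hq, embeddingDimension_invariants p M hp hγ hη hq⟩
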